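/- **Setting.** A bivariate copula $C$ is the joint distribution function $C(u,v)=P(U\le u,V\le v)$ of two random variables that are uniformly distributed on $[0,1]$. If the law of $(U,V)$ is absolutely continuous with density $c$, the *negative copula entropy* is $$-H(C)=\int_{[0,1]^2} c\log c\;du\,dv\in[0,\infty],$$ and it equals the mutual information $MI(X;Y)$ (the Kullback–Leibler divergence of the law of $(X,Y)$ from the product of its marginal laws) of every random vector $(X,Y)$ with continuous marginal distribution functions and copula $C$. For laws of bivariate random vectors write $X\le_{SM}X'$ if $E\,\Psi(X)\le E\,\Psi(X')$ for every supermodular $\Psi:\mathbb R^2\to\mathbb R$ (that is, $\Psi(p)+\Psi(q)\le\Psi(p\vee q)+\Psi(p\wedge q)$ with coordinatewise maximum and minimum) for which both expectations exist. A function $c\ge 0$ is TP2 if $c(p)c(q)\le c(p\vee q)c(p\wedge q)$ for all $p,q$, and RR2 if the reverse inequality holds. A copula has a TP2 (RR2) density if some version of its density is TP2 (RR2) on $(0,1)^2$. An Archimedean copula with generator $\phi$ is a copula of the form $C(u,v)=\phi(\phi^{-1}(u)+\phi^{-1}(v))$ for $u,v\in(0,1]$, where $\phi:[0,\infty)\to[0,\infty)$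 is strictly convex, $\phi(\infty)=0$, and the range of $\phi$ contains $(0,1]$. A function $\phi$ on $[0,\infty)$ is completely monotone if it is continuous on $[0,\infty)$ and smooth on $(0,\infty)$ with $(-1)^n\phi^{(n)}\ge 0$ there for all $n\ge 0$. **Theorem.** Let $\Theta\subseteq\mathbb R$ and let $(C_\theta)_{\theta\in\Theta}$ be a family of absolutely continuous bivariate copulas. Assume that one of the following conditions holds. (a) Either $\Theta\subseteq[0,\infty)$, $C_{\theta}\le_{SM}C_{\theta'}$ for all $\theta\le\theta'$ in $\Theta$, and every $C_\theta$ has a TP2 density; or $\Theta\subseteq(-\infty,0]$, $C_{\theta}\le_{SM}C_{\theta'}$ for all $\theta\le\theta'$ in $\Theta$ (so that the copula decreases as $\theta$ moves down from $0$), and every $C_\theta$ has an RR2 density. (b) Every $C_\theta$ is an Archimedean copula with a completely monotone generator $\phi_\theta$ such that $\phi_\theta(0)=1$, and $C_{\theta_1}\le_{SM}C_{\theta_2}$ for all $\theta_1,\theta_2\in\Theta$ with $0\le\theta_1\le\theta_2$ or $\theta_2\le\theta_1\le0$. (c) $C_\theta=C_{\theta,\delta}$ for a fixed $\delta$, where $C_{\theta,\delta}$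 is a two-parameter Archimedean family $$C_{\theta,\delta}(u,v)=\psi_\theta\bigl(-\log K_\delta(e^{-\psi_\theta^{-1}(u)},e^{-\psi_\theta^{-1}(v)})\bigr),\qquad u,v\in(0,1],$$ with $\psi_\theta$ the Laplace transform of the law of a positive random variable and $K_\delta$ an Archimedean copula with generator $\varphi_\delta$; the generator $\eta_{\theta,\delta}(s)=\psi_\theta(-\log\varphi_\delta(s))$ is completely monotone with $\eta_{\theta,\delta}(0)=1$; and $C_{\theta_1,\delta}\le_{SM}C_{\theta_2,\delta}$ for all $\theta_1,\theta_2\in\Theta$ with $0\le\theta_1\le\theta_2$ or $\theta_2\le\theta_1\le0$. (d) $(C_\theta)$ is a family of elliptical copulas: $\Theta\subseteq(-1,1)$ and there is a density generator $g\ge0$ with $\int_0^\infty\pi g(t)\,dt=1$, not depending on $\theta$, such that $C_\theta$ is the copula of the elliptical distribution on $\mathbb R^2$ with density $$(1-\theta^2)^{-1/2}\,g\!\left(\frac{x^2-2\theta xy+y^2}{1-\theta^2}\right).$$ Then for all $\theta_1,\theta_2\in\Theta$ with $0\le\theta_1\le\theta_2$ or $\theta_2\le\theta_1\le0$, $$-H(C_{\theta_1})\le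 -H(C_{\theta_2}),$$ and likewise $MI(X_1;Y_1)\le MI(X_2;Y_2)$ for all random vectors $(X_i,Y_i)$ with continuous marginal distribution functions and copula $C_{\theta_i}$, $i=1,2$. -/

import Mathlib

open Set Filter Topology MeasureTheory

noncomputable section

/-- A bivariate copula, given by the joint law of two random variables that are both uniformly
distributed on `[0, 1]`. -/
structure Copula where
  law : Measure (ℝ × ℝ)
  fst_law : law.fst = volume.restrict (Icc (0 : ℝ) 1)
  snd_law : law.snd = volume.restrict (Icc (0 : ℝ) 1)

namespace Copula

/-- The copula function `C(u, v) = P(U ≤ u, V ≤ v)`. -/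
def cdf (C : Copula) (u v : ℝ) : ℝ :=
  C.law.real (Iic u ×ˢ Iic v)

/-- Absolute continuity with respect to Lebesgue measure on the plane. -/
def AbsCont (C : Copula) : Prop :=
  C.law ≪ (volume : Measure (ℝ × ℝ))

/-- `c` is (a version of) the copula density of `C`. -/
structure IsDensity (C : Copula) (c : ℝ × ℝ → ℝ) : Prop where
  measurable : Measurable c
  nonneg : ∀ p, 0 ≤ c p
  law_eq : C.law =
    (volume.restrict (Icc (0 : ℝ) 1 ×ˢ Icc (0 : ℝ) 1)).withDensity fun p => ENNReal.ofReal (c p)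

/-- The copula density as the Radon-Nikodym derivative. -/
def density (C : Copula) (p : ℝ × ℝ) : ℝ :=
  (C.law.rnDeriv volume p).toReal

/-- The negative copula entropy `-H(C) = ∫ c log c` over the unit square, as an extended real
number: integral of the positive part minus integral of the negative part. The latter is always
finite because `x log x ≥ -1/e`, so the value is a real number or `+∞`. -/
def negEntropy (C : Copula) : EReal :=
  ((∫⁻ p in Icc (0 : ℝ) 1 ×ˢ Icc (0 : ℝ) 1,
      ENNReal.ofReal (C.density p * Real.log (C.density p)) : ENNReal) : EReal)
  - ((∫⁻ p in Icc (0 : ℝ) 1 ×ˢ Icc (0 : ℝ) 1,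
      ENNReal.ofReal (-(C.density p * Real.log (C.density p))) : ENNReal) : EReal)

end Copula

/-- Total positivity of order two on `S` (the lattice operations are coordinatewise). -/
def TP2On (c : ℝ × ℝ → ℝ) (S : Set (ℝ × ℝ)) : Prop :=
  ∀ p ∈ S, ∀ q ∈ S, c p * c q ≤ c (p ⊔ q) * c (p ⊓ q)

/-- Reverse rule of order two on `S`. -/
def RR2On (c : ℝ × ℝ → ℝ) (S : Set (ℝ × ℝ)) : Prop :=
  ∀ p ∈ S, ∀ q ∈ S, c (p ⊔ q) * c (p ⊓ q) ≤ c p * c q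

/-- Some version of the copula density is TP2 on the open unit square. -/
def Copula.HasTP2Density (C : Copula) : Prop :=
  ∃ c : ℝ × ℝ → ℝ, C.IsDensity c ∧ TP2On c (Ioo (0 : ℝ) 1 ×ˢ Ioo (0 : ℝ) 1)

/-- Some version of the copula density is RR2 on the open unit square. -/
def Copula.HasRR2Density (C : Copula) : Prop :=
  ∃ c : ℝ × ℝ → ℝ, C.IsDensity c ∧ RR2On c (Ioo (0 : ℝ) 1 ×ˢ Ioo (0 : ℝ) 1)

/-- Supermodular functions on the plane. -/
def IsSupermodular (Ψ : ℝ × ℝ → ℝ) : Prop :=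
  ∀ p q : ℝ × ℝ, Ψ p + Ψ q ≤ Ψ (p ⊔ q) + Ψ (p ⊓ q)

/-- The supermodular order between laws of bivariate random vectors: `E Ψ(X) ≤ E Ψ(X')` for every
supermodular `Ψ` for which both expectations exist. -/
def SMOrder (μ ν : Measure (ℝ × ℝ)) : Prop :=
  ∀ Ψ : ℝ × ℝ → ℝ, IsSupermodular Ψ → Integrable Ψ μ → Integrable Ψ ν →
    ∫ p, Ψ p ∂μ ≤ ∫ p, Ψ p ∂ν

/-- `P` is the law of a bivariate random vector with continuous marginal distribution functions
`F`, `G` and copula `C`: its joint distribution function is `C(F(x), G(y))`. -/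
structure HasCopula (P : Measure (ℝ × ℝ)) (C : Copula) : Prop where
  isProbabilityMeasure : IsProbabilityMeasure P
  fst_nullSingleton : NullSingletonClass P.fst
  snd_nullSingleton : NullSingletonClass P.snd
  cdf_eq : ∀ x y : ℝ,
    P.real (Iic x ×ˢ Iic y) = C.cdf (P.fst.real (Iic x)) (P.snd.real (Iic y))

/-- Shannon's mutual information of the two coordinates of a random vector with law `P`. -/
def mutualInfo (P : Measure (ℝ × ℝ)) : ENNReal :=
  InformationTheory.klDiv P (P.fst.prod P.snd)

/-- `0 ≤ θ₁ ≤ θ₂`, or `θ₂ ≤ θ₁ ≤ 0`. -/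
def AwayFromZero (θ₁ θ₂ : ℝ) : Prop :=
  (0 ≤ θ₁ ∧ θ₁ ≤ θ₂) ∨ (θ₂ ≤ θ₁ ∧ θ₁ ≤ 0)

/-- For a family of copulas with parameter set `Θ`: whenever `0 ≤ θ₁ ≤ θ₂` or `θ₂ ≤ θ₁ ≤ 0`, the
negative copula entropy at `θ₁` is at most that at `θ₂`, and so is the mutual information of
random vectors having these copulas. -/
def EntropyMonotone (Θ : Set ℝ) (C : ℝ → Copula) : Prop :=
  ∀ θ₁ ∈ Θ, ∀ θ₂ ∈ Θ, AwayFromZero θ₁ θ₂ →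
    (C θ₁).negEntropy ≤ (C θ₂).negEntropy ∧
    ∀ P P' : Measure (ℝ × ℝ), HasCopula P (C θ₁) → HasCopula P' (C θ₂) →
      mutualInfo P ≤ mutualInfo P'

/-- The inverse `ψ⁻¹` of a generator, regarded as a function on `[0, ∞)`. -/
def genInv (ψ : ℝ → ℝ) (u : ℝ) : ℝ :=
  Function.invFunOn ψ (Ici 0) u

/-- `C` is the Archimedean copula with generator `ψ : [0, ∞) → [0, ∞)`, that is
`C(u, v) = ψ(ψ⁻¹(u) + ψ⁻¹(v))`; the condition `surjOn` says that `ψ⁻¹` is defined on `(0, 1]`. -/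
structure IsArchimedean (C : Copula) (ψ : ℝ → ℝ) : Prop where
  nonneg : ∀ s, 0 ≤ s → 0 ≤ ψ s
  strictConvexOn : StrictConvexOn ℝ (Ici 0) ψ
  tendsto_zero : Tendsto ψ atTop (𝓝 0)
  surjOn : SurjOn ψ (Ici 0) (Ioc 0 1)
  cdf_eq : ∀ u ∈ Ioc (0 : ℝ) 1, ∀ v ∈ Ioc (0 : ℝ) 1,
    C.cdf u v = ψ (genInv ψ u + genInv ψ v)

/-- Complete monotonicity on `[0, ∞)`: continuous there, smooth on `(0, ∞)`, with derivatives of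
alternating signs. -/
structure IsCompletelyMonotone (ψ : ℝ → ℝ) : Prop where
  continuousOn : ContinuousOn ψ (Ici 0)
  contDiffOn : ContDiffOn ℝ (⊤ : ℕ∞) ψ (Ioi 0)
  alternating : ∀ (n : ℕ) (s : ℝ), 0 < s → 0 ≤ (-1) ^ n * iteratedDeriv n ψ s

/-- `ψ` is, on `[0, ∞)`, the Laplace transform of the law of a positive random variable. -/
def IsLaplaceTransform (ψ : ℝ → ℝ) : Prop :=
  ∃ M : Measure ℝ, IsProbabilityMeasure M ∧ M (Iic 0) = 0 ∧
    ∀ s, 0 ≤ s → ψ s = ∫ α, Real.exp (-(s * α)) ∂M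

/-- A member of a two-parameter Archimedean family,
`C(u, v) = ψ(-log K(exp(-ψ⁻¹(u)), exp(-ψ⁻¹(v))))`, where `K` is the Archimedean copula with
generator `φ` and `ψ` is a Laplace transform. -/
structure IsTwoParamArchimedean (C K : Copula) (ψ φ : ℝ → ℝ) : Prop where
  inner : IsArchimedean K φ
  laplace : IsLaplaceTransform ψ
  cdf_eq : ∀ u ∈ Ioc (0 : ℝ) 1, ∀ v ∈ Ioc (0 : ℝ) 1,
    C.cdf u v =
      ψ (-Real.log (K.cdf (Real.exp (-genInv ψ u)) (Real.exp (-genInv ψ v))))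

/-- The generator `η(s) = ψ(-log φ(s))` of a two-parameter Archimedean copula. -/
def twoParamGenerator (ψ φ : ℝ → ℝ) (s : ℝ) : ℝ :=
  ψ (-Real.log (φ s))

/-- `g` is the density generator of a bivariate elliptical distribution: `x ↦ g(|x|²)` is a
probability density on the plane, which in polar coordinates reads `∫₀^∞ π g(t) dt = 1`. -/
structure IsDensityGenerator (g : ℝ → ℝ) : Prop where
  measurable : Measurable g
  nonneg : ∀ t, 0 ≤ t → 0 ≤ g t
  lintegral_eq : ∫⁻ t in Ioi (0 : ℝ), ENNReal.ofReal (Real.pi * g t) = 1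

/-- The centred elliptical distribution with density generator `g` and dispersion matrix
`Σ = !![1, θ; θ, 1]`, with density `(det Σ)^(-1/2) g(xᵀ Σ⁻¹ x)`. -/
def ellipticalLaw (g : ℝ → ℝ) (θ : ℝ) : Measure (ℝ × ℝ) :=
  volume.withDensity fun p =>
    ENNReal.ofReal
      (g ((p.1 ^ 2 - 2 * θ * p.1 * p.2 + p.2 ^ 2) / (1 - θ ^ 2)) / Real.sqrt (1 - θ ^ 2))

end

noncomputable section

/-! ### Convex sums over TP2 matrices -/

/-! For an absolutely continuous copula with density `c`, both the negative entropy and the mutual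
information of any vector with that copula equal the divergence `∫ klFun c`, where `klFun x = x log
x + 1 - x`: the mass of `c` and the area of the square are both one, and the probability integral
transform carries the product of the marginals to Lebesgue measure on the square. Only divergences
have to be compared.

Cases (a), (b) and (c) rest on a finite inequality, `sum_klFun_le_of_tp2`. Let `a` be a TP2 matrix
and `b` a nonnegative matrix with the same marginals and larger cumulative sums. Convexity gives `∑
klFun b ≥ ∑ klFun a + ∑ (b - a) log a`. Two-dimensional summation by parts writes the last sum as
cumulative sums of `b - a` times mixed second differences of `log a`. The former are nonnegative by
the order, the latter by TP2. Zeros of `a` are harmless because they force corners to vanish.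
Reversing the columns gives the RR2 version.

Applied to cell masses on an `n × n` grid, this compares discretized divergences without any
regularity of `log c`. Jensen's inequality bounds each of them by the true divergence, and Lebesgue
differentiation with Fatou's lemma gives the converse in the limit.

For Archimedean copulas the required TP2 property is proved directly on rectangles. In the
coordinates given by the inverse generator, a rectangle mass is a mixed difference of `η (x + y)`,
hence a double integral of `η''(x + y)`. This kernel is TP2 because completely monotone functions
are log-convex. Log-convexity comes from an induction on derivatives
(`IsAlternatingDerivs.mul_sq_le`), not from an integral representation.

Case (d) uses no order. All the elliptical laws are images of one spherical vector `(Z₁, Z₂)` under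
`(Z₁, W)` with `W = θ Z₁ + √(1 - θ²) Z₂`, and `W` has the law of `Z₁`. In the log-likelihood ratio
only the marginal term at `W` and the constant `-log √(1 - θ²)` depend on `θ`. The marginal terms at
two parameters have the same law, so their difference has mean zero, and the constant increases with
`θ²`. -/

theorem sum_range_succ_mul_eq_abel (d L : ℕ → ℝ) (m : ℕ) :
    ∑ i ∈ Finset.range (m + 1), d i * L i =
      ∑ i ∈ Finset.range m, (∑ k ∈ Finset.range (i + 1), d k) * (L i - L (i + 1)) +
        (∑ k ∈ Finset.range (m + 1), d k) * L m := by
  induction m with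
  | zero => simp
  | succ m ih =>
    rw [Finset.sum_range_succ, ih, Finset.sum_range_succ (fun i => _ * (L i - L (i + 1))) m,
      Finset.sum_range_succ d (m + 1)]
    ring

/-- Two-dimensional summation by parts for an array with vanishing row and column sums. -/
theorem sum_sum_mul_eq_abel (d L : ℕ → ℕ → ℝ) (m : ℕ)
    (hrow : ∀ i < m + 1, ∑ j ∈ Finset.range (m + 1), d i j = 0)
    (hcol : ∀ j < m + 1, ∑ i ∈ Finset.range (m + 1), d i j = 0) :
    ∑ i ∈ Finset.range (m + 1), ∑ j ∈ Finset.range (m + 1), d i j * L i j =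
      ∑ i ∈ Finset.range m, ∑ j ∈ Finset.range m,
        (∑ k ∈ Finset.range (i + 1), ∑ l ∈ Finset.range (j + 1), d k l) *
          (L i j - L i (j + 1) - L (i + 1) j + L (i + 1) (j + 1)) := by
  have h1 : ∀ i ∈ Finset.range (m + 1), ∑ j ∈ Finset.range (m + 1), d i j * L i j =
      ∑ j ∈ Finset.range m, (∑ l ∈ Finset.range (j + 1), d i l) * (L i j - L i (j + 1)) := by
    intro i hi
    rw [sum_range_succ_mul_eq_abel, hrow i (Finset.mem_range.1 hi), zero_mul, add_zero]
  rw [Finset.sum_congr rfl h1, Finset.sum_comm]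
  have h2 : ∀ j ∈ Finset.range m,
      ∑ i ∈ Finset.range (m + 1), (∑ l ∈ Finset.range (j + 1), d i l) * (L i j - L i (j + 1)) =
      ∑ i ∈ Finset.range m, (∑ k ∈ Finset.range (i + 1), ∑ l ∈ Finset.range (j + 1), d k l) *
        (L i j - L i (j + 1) - L (i + 1) j + L (i + 1) (j + 1)) := by
    intro j hj
    rw [sum_range_succ_mul_eq_abel (fun i => ∑ l ∈ Finset.range (j + 1), d i l)
      (fun i => L i j - L i (j + 1))]
    have h0 : ∑ k ∈ Finset.range (m + 1), ∑ l ∈ Finset.range (j + 1), d k l = 0 := by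
      rw [Finset.sum_comm]
      refine Finset.sum_eq_zero fun l hl => hcol l ?_
      have := Finset.mem_range.1 hl
      have := Finset.mem_range.1 hj
      omega
    rw [h0, zero_mul, add_zero]
    exact Finset.sum_congr rfl fun i _ => by ring
  rw [Finset.sum_congr rfl h2, Finset.sum_comm]

/-- A zero of a TP2 matrix without zero rows and columns forces a whole corner to vanish. -/
theorem corner_eq_zero_of_tp2 {n : ℕ} {a : ℕ → ℕ → ℝ}
    (ha : ∀ i < n, ∀ j < n, 0 ≤ a i j)
    (hrow : ∀ i < n, 0 < ∑ j ∈ Finset.range n, a i j)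
    (hcol : ∀ j < n, 0 < ∑ i ∈ Finset.range n, a i j)
    (htp : ∀ i i' j j', i < i' → i' < n → j < j' → j' < n → a i j' * a i' j ≤ a i j * a i' j')
    {i j : ℕ} (hi : i < n) (hj : j < n) (h0 : a i j = 0) :
    (∀ k ≤ i, ∀ l, j ≤ l → l < n → a k l = 0) ∨ (∀ k, i ≤ k → k < n → ∀ l ≤ j, a k l = 0) := by
  obtain ⟨j', hj', hpj⟩ : ∃ j' < n, 0 < a i j' := by
    by_contra! h
    exact absurd (hrow i hi) (not_lt.2 (Finset.sum_nonpos fun l hl => h l (Finset.mem_range.1 hl)))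
  obtain ⟨i', hi', hpi⟩ : ∃ i' < n, 0 < a i' j := by
    by_contra! h
    exact absurd (hcol j hj) (not_lt.2 (Finset.sum_nonpos fun l hl => h l (Finset.mem_range.1 hl)))
  have key : ∀ {x y : ℝ}, 0 ≤ x → 0 < y → x * y ≤ 0 → x = 0 := by
    intro x y hx hy h
    by_contra hne
    exact absurd h (not_le.2 (mul_pos (lt_of_le_of_ne hx (Ne.symm hne)) hy))
  have hjj : j' ≠ j := by rintro rfl; rw [h0] at hpj; exact lt_irrefl _ hpj
  have hii : i' ≠ i := by rintro rfl; rw [h0] at hpi; exact lt_irrefl _ hpi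
  -- If the positive entries of row `i` and column `j` are both before or both after `(i, j)`, their
  -- product is bounded by a product containing the zero. Otherwise TP2 minors spread the zero along
  -- row `i`, and then to the rows above or below.
  rcases lt_or_gt_of_ne hjj with hjl | hjl <;> rcases lt_or_gt_of_ne hii with hil | hil
  · have := htp i' i j' j hil hi hjl hj
    rw [h0, mul_zero] at this
    exact absurd this (not_le.2 (mul_pos hpi hpj))
  · left
    have hrowz : ∀ l, j ≤ l → l < n → a i l = 0 := by
      intro l hl hln
      rcases hl.eq_or_lt with rfl | hl
      · exact h0
      · have := htp i i' j l hil hi' hl hln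
        rw [h0, zero_mul] at this
        exact key (ha _ hi _ hln) hpi this
    intro k hk l hl hln
    rcases hk.eq_or_lt with rfl | hk
    · exact hrowz l hl hln
    · have := htp k i j' l hk hi (hjl.trans_le hl) hln
      rw [hrowz l hl hln, mul_zero] at this
      exact key (ha _ (hk.trans hi) _ hln) hpj this
  · right
    have hrowz : ∀ l ≤ j, a i l = 0 := by
      intro l hl
      rcases hl.eq_or_lt with rfl | hl
      · exact h0
      · have := htp i' i l j hil hi hl hj
        rw [h0, mul_zero, mul_comm] at this
        exact key (ha _ hi _ (hl.trans hj)) hpi this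
    intro k hk hkn l hl
    rcases hk.eq_or_lt with rfl | hk
    · exact hrowz l hl
    · have := htp i k l j' hk hkn (hl.trans_lt hjl) hj'
      rw [hrowz l hl, zero_mul, mul_comm] at this
      exact key (ha _ hkn _ (hl.trans_lt hj)) hpj this
  · have := htp i i' j j' hil hi' hjl hj'
    rw [h0, zero_mul] at this
    exact absurd this (not_le.2 (mul_pos hpj hpi))

/-- All the mass of `a` in the first `I` rows lies in the first `J` columns, so its cumulative sum
already equals the common row total. That of `b` is at least as large but cannot exceed this total,
which leaves no mass of `b` beyond column `J`. -/
theorem upper_corner_eq {n : ℕ} {a b : ℕ → ℕ → ℝ} (hb : ∀ i < n, ∀ j < n, 0 ≤ b i j)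
    (hrow : ∀ i < n, ∑ j ∈ Finset.range n, a i j = ∑ j ∈ Finset.range n, b i j)
    (hD : ∀ i ≤ n, ∀ j ≤ n, ∑ k ∈ Finset.range i, ∑ l ∈ Finset.range j, a k l ≤
      ∑ k ∈ Finset.range i, ∑ l ∈ Finset.range j, b k l)
    {I J : ℕ} (hI : I ≤ n) (hJ : J ≤ n) (h0 : ∀ k < I, ∀ l, J ≤ l → l < n → a k l = 0) :
    (∑ k ∈ Finset.range I, ∑ l ∈ Finset.range J, a k l =
      ∑ k ∈ Finset.range I, ∑ l ∈ Finset.range J, b k l) ∧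
    ∀ k < I, ∀ l, J ≤ l → l < n → b k l = 0 := by
  have e : ∀ c : ℕ → ℕ → ℝ, ∑ k ∈ Finset.range I, ∑ l ∈ Finset.range n, c k l =
      ∑ k ∈ Finset.range I, ∑ l ∈ Finset.range J, c k l +
        ∑ k ∈ Finset.range I, ∑ l ∈ Finset.Ico J n, c k l := by
    intro c
    rw [← Finset.sum_add_distrib]
    exact Finset.sum_congr rfl fun k _ => (Finset.sum_range_add_sum_Ico _ hJ).symm
  have ea : ∑ k ∈ Finset.range I, ∑ l ∈ Finset.Ico J n, a k l = 0 :=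
    Finset.sum_eq_zero fun k hk => Finset.sum_eq_zero fun l hl =>
      h0 k (Finset.mem_range.1 hk) l (Finset.mem_Ico.1 hl).1 (Finset.mem_Ico.1 hl).2
  have hbn : ∀ k ∈ Finset.range I, 0 ≤ ∑ l ∈ Finset.Ico J n, b k l := fun k hk =>
    Finset.sum_nonneg fun l hl => hb k ((Finset.mem_range.1 hk).trans_le hI) l
      (Finset.mem_Ico.1 hl).2
  have er : ∑ k ∈ Finset.range I, ∑ l ∈ Finset.range n, a k l =
      ∑ k ∈ Finset.range I, ∑ l ∈ Finset.range n, b k l :=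
    Finset.sum_congr rfl fun k hk => hrow k ((Finset.mem_range.1 hk).trans_le hI)
  have hs := Finset.sum_nonneg hbn
  have hd := hD I hI J hJ
  rw [e a, e b, ea] at er
  have ez : ∑ k ∈ Finset.range I, ∑ l ∈ Finset.Ico J n, b k l = 0 := by linarith
  refine ⟨by linarith, fun k hk l hl hln => ?_⟩
  have h1 := (Finset.sum_eq_zero_iff_of_nonneg hbn).1 ez k (Finset.mem_range.2 hk)
  exact (Finset.sum_eq_zero_iff_of_nonneg fun l hl => hb k (hk.trans_le hI) l
    (Finset.mem_Ico.1 hl).2).1 h1 l (Finset.mem_Ico.2 ⟨hl, hln⟩)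

/-- This is the tangent inequality for the convex function `klFun`, whose derivative is `log`. The
last hypothesis covers `x = 0`, where the slope is `-∞` but `Real.log 0 = 0`. -/
theorem klFun_add_log_mul_le {x y : ℝ} (hx : 0 ≤ x) (hy : 0 ≤ y) (h : x = 0 → y = 0) :
    InformationTheory.klFun x + (y - x) * Real.log x ≤ InformationTheory.klFun y := by
  rcases hx.eq_or_lt with rfl | hx
  · simp [h rfl]
  rcases hy.eq_or_lt with rfl | hy
  · simp only [InformationTheory.klFun_apply, zero_mul, zero_add, sub_zero]
    nlinarith
  simp only [InformationTheory.klFun_apply]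
  have h1 := Real.log_le_sub_one_of_pos (div_pos hx hy)
  rw [Real.log_div hx.ne' hy.ne'] at h1
  have h2 := mul_le_mul_of_nonneg_left h1 hy.le
  have h3 : y * (x / y - 1) = x - y := by field_simp
  nlinarith

/-- Among nonnegative matrices with the same marginals, a TP2 matrix has the smallest relative
entropy compared with every matrix that dominates it in the concordance order. -/
theorem sum_klFun_le_of_tp2 {n : ℕ} {a b : ℕ → ℕ → ℝ}
    (ha : ∀ i < n, ∀ j < n, 0 ≤ a i j) (hb : ∀ i < n, ∀ j < n, 0 ≤ b i j)
    (hrow0 : ∀ i < n, 0 < ∑ j ∈ Finset.range n, a i j)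
    (hcol0 : ∀ j < n, 0 < ∑ i ∈ Finset.range n, a i j)
    (hrow : ∀ i < n, ∑ j ∈ Finset.range n, a i j = ∑ j ∈ Finset.range n, b i j)
    (hcol : ∀ j < n, ∑ i ∈ Finset.range n, a i j = ∑ i ∈ Finset.range n, b i j)
    (htp : ∀ i i' j j', i < i' → i' < n → j < j' → j' < n → a i j' * a i' j ≤ a i j * a i' j')
    (hD : ∀ i ≤ n, ∀ j ≤ n, ∑ k ∈ Finset.range i, ∑ l ∈ Finset.range j, a k l ≤
      ∑ k ∈ Finset.range i, ∑ l ∈ Finset.range j, b k l) :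
    ∑ i ∈ Finset.range n, ∑ j ∈ Finset.range n, InformationTheory.klFun (a i j) ≤
      ∑ i ∈ Finset.range n, ∑ j ∈ Finset.range n, InformationTheory.klFun (b i j) := by
  have hcorner := fun {i j} => corner_eq_zero_of_tp2 ha hrow0 hcol0 htp (i := i) (j := j)
  have hup := fun {I J} => upper_corner_eq hb hrow hD (I := I) (J := J)
  have hlow : ∀ {I J : ℕ}, I ≤ n → J ≤ n → (∀ k, I ≤ k → k < n → ∀ l < J, a k l = 0) →
      (∑ k ∈ Finset.range I, ∑ l ∈ Finset.range J, a k l =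
        ∑ k ∈ Finset.range I, ∑ l ∈ Finset.range J, b k l) ∧
      ∀ k, I ≤ k → k < n → ∀ l < J, b k l = 0 := by
    intro I J hI hJ h
    have := upper_corner_eq (a := fun i j => a j i) (b := fun i j => b j i)
      (fun i hi j hj => hb j hj i hi) hcol (fun i hi j hj => by
        rw [Finset.sum_comm, Finset.sum_comm (f := fun k l => b l k)]
        exact hD j hj i hi) hJ hI (fun l hl k hk hkn => h k hk hkn l hl)
    refine ⟨?_, fun k hk hkn l hl => this.2 l hl k hk hkn⟩
    rw [Finset.sum_comm, Finset.sum_comm (f := fun k l => b k l)]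
    exact this.1
  -- A zero of `a` lies in a vanishing corner, and the corner comparison transfers it to `b`; this
  -- makes the tangent inequality available at every entry.
  have hac : ∀ i < n, ∀ j < n, a i j = 0 → b i j = 0 := by
    intro i hi j hj h0
    rcases hcorner hi hj h0 with h | h
    · exact (hup (I := i + 1) (J := j) hi hj.le fun k hk l hl hln =>
        h k (Nat.lt_succ_iff.1 hk) l hl hln).2 i (Nat.lt_succ_self i) j le_rfl hj
    · exact (hlow (I := i) (J := j + 1) hi.le hj fun k hk hkn l hl =>
        h k hk hkn l (Nat.lt_succ_iff.1 hl)).2 i le_rfl hi j (Nat.lt_succ_self j)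
  have hmain : 0 ≤ ∑ i ∈ Finset.range n, ∑ j ∈ Finset.range n,
      (b i j - a i j) * Real.log (a i j) := by
    rcases n with _ | m
    · simp
    rw [sum_sum_mul_eq_abel (fun i j => b i j - a i j) (fun i j => Real.log (a i j)) m
      (fun i hi => by rw [Finset.sum_sub_distrib, hrow i hi, sub_self])
      (fun j hj => by rw [Finset.sum_sub_distrib, hcol j hj, sub_self])]
    refine Finset.sum_nonneg fun i hi => Finset.sum_nonneg fun j hj => ?_
    have him := Finset.mem_range.1 hi
    have hjm := Finset.mem_range.1 hj
    have hi1 : i + 1 < m + 1 := by omega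
    have hj1 : j + 1 < m + 1 := by omega
    simp only [Finset.sum_sub_distrib]
    -- If one of the four entries of an elementary minor vanishes, the corner containing it covers a
    -- whole side of the block cut at `(i + 1, j + 1)`. The cumulative difference is then zero and
    -- cancels the meaningless value of the logarithm.
    have hzero : ∀ x y, i ≤ x → x ≤ i + 1 → j ≤ y → y ≤ j + 1 → a x y = 0 →
        ∑ k ∈ Finset.range (i + 1), ∑ l ∈ Finset.range (j + 1), a k l =
          ∑ k ∈ Finset.range (i + 1), ∑ l ∈ Finset.range (j + 1), b k l := by
      intro x y hx hx' hy hy' h0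
      rcases hcorner (by omega) (by omega) h0 with h | h
      · exact (hup hi1.le hj1.le fun k hk l hl hln => h k (by omega) l (by omega) hln).1
      · exact (hlow hi1.le hj1.le fun k hk hkn l hl => h k (by omega) hkn l (by omega)).1
    by_cases hz : ∃ x y, i ≤ x ∧ x ≤ i + 1 ∧ j ≤ y ∧ y ≤ j + 1 ∧ a x y = 0
    · obtain ⟨x, y, h1, h2, h3, h4, h5⟩ := hz
      rw [hzero x y h1 h2 h3 h4 h5, sub_self, zero_mul]
    push Not at hz
    have hpos : ∀ x y, i ≤ x → x ≤ i + 1 → j ≤ y → y ≤ j + 1 → 0 < a x y :=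
      fun x y h1 h2 h3 h4 => lt_of_le_of_ne (ha x (by omega) y (by omega))
        (Ne.symm (hz x y h1 h2 h3 h4))
    refine mul_nonneg (sub_nonneg.2 (hD _ hi1.le _ hj1.le)) ?_
    have p1 := hpos i j (by omega) (by omega) (by omega) (by omega)
    have p2 := hpos i (j + 1) (by omega) (by omega) (by omega) (by omega)
    have p3 := hpos (i + 1) j (by omega) (by omega) (by omega) (by omega)
    have p4 := hpos (i + 1) (j + 1) (by omega) (by omega) (by omega) (by omega)
    have := Real.log_le_log (mul_pos p2 p3) (htp i (i + 1) j (j + 1) (by omega) hi1 (by omega) hj1)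
    rw [Real.log_mul p2.ne' p3.ne', Real.log_mul p1.ne' p4.ne'] at this
    linarith
  have hle : ∑ i ∈ Finset.range n, ∑ j ∈ Finset.range n, (InformationTheory.klFun (a i j) +
      (b i j - a i j) * Real.log (a i j)) ≤
      ∑ i ∈ Finset.range n, ∑ j ∈ Finset.range n, InformationTheory.klFun (b i j) :=
    Finset.sum_le_sum fun i hi => Finset.sum_le_sum fun j hj =>
      klFun_add_log_mul_le (ha i (Finset.mem_range.1 hi) j (Finset.mem_range.1 hj))
        (hb i (Finset.mem_range.1 hi) j (Finset.mem_range.1 hj))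
        (hac i (Finset.mem_range.1 hi) j (Finset.mem_range.1 hj))
  simp only [Finset.sum_add_distrib] at hle
  linarith

/-! ### Elementary properties of copulas -/

namespace Copula

instance isProbabilityMeasure_law (C : Copula) : IsProbabilityMeasure C.law := by
  constructor
  rw [← Measure.fst_univ, C.fst_law, Measure.restrict_apply_univ, Real.volume_Icc]
  norm_num

theorem real_Iic_prod_univ (C : Copula) {u : ℝ} (hu : u ∈ Icc (0 : ℝ) 1) :
    C.law.real (Iic u ×ˢ univ) = u := by
  have : C.law (Iic u ×ˢ univ) = ENNReal.ofReal u := by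
    rw [prod_univ, ← Measure.fst_apply measurableSet_Iic, C.fst_law,
      Measure.restrict_apply measurableSet_Iic]
    have : Iic u ∩ Icc 0 1 = Icc 0 u := by
      ext x; simp only [mem_inter_iff, mem_Iic, mem_Icc]
      exact ⟨fun h => ⟨h.2.1, h.1⟩, fun h => ⟨h.2, h.1, h.2.trans hu.2⟩⟩
    rw [this, Real.volume_Icc, sub_zero]
  rw [measureReal_def, this, ENNReal.toReal_ofReal hu.1]

/-- The copula with the coordinates interchanged. -/
def swap (C : Copula) : Copula where
  law := C.law.map Prod.swap
  fst_law := by rw [Measure.fst_map_swap, C.snd_law]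
  snd_law := by rw [Measure.snd_map_swap, C.fst_law]

theorem cdf_swap (C : Copula) (u v : ℝ) : C.swap.cdf u v = C.cdf v u := by
  rw [cdf, cdf, swap, map_measureReal_apply measurable_swap (measurableSet_Iic.prod measurableSet_Iic),
    preimage_swap_prod]

theorem cdf_mono_left (C : Copula) {u u' : ℝ} (h : u ≤ u') (v : ℝ) : C.cdf u v ≤ C.cdf u' v :=
  measureReal_mono (prod_mono_left (Iic_subset_Iic.2 h))

theorem cdf_nonneg (C : Copula) (u v : ℝ) : 0 ≤ C.cdf u v := measureReal_nonneg

theorem cdf_zero_left (C : Copula) (v : ℝ) : C.cdf 0 v = 0 :=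
  le_antisymm ((measureReal_mono (prod_mono_right (subset_univ _))).trans
    (C.real_Iic_prod_univ ⟨le_rfl, zero_le_one⟩).le) (C.cdf_nonneg _ _)

theorem cdf_zero_right (C : Copula) (u : ℝ) : C.cdf u 0 = 0 := by
  rw [← cdf_swap, cdf_zero_left]

theorem real_univ_prod_Ioi (C : Copula) : C.law.real (univ ×ˢ Ioi 1) = 0 := by
  have h : C.law (univ ×ˢ Ioi 1) = 0 := by
    rw [univ_prod, ← Measure.snd_apply measurableSet_Ioi, C.snd_law,
      Measure.restrict_apply measurableSet_Ioi]
    have : Ioi (1 : ℝ) ∩ Icc 0 1 = ∅ := by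
      ext x; simp only [mem_inter_iff, mem_Ioi, mem_Icc, mem_empty_iff_false, iff_false]
      intro h; linarith [h.1, h.2.2]
    rw [this, measure_empty]
  rw [measureReal_def, h, ENNReal.toReal_zero]

theorem cdf_one_right (C : Copula) {u : ℝ} (hu : u ∈ Icc (0 : ℝ) 1) : C.cdf u 1 = u := by
  refine le_antisymm ((measureReal_mono (prod_mono_right (subset_univ _))).trans
    (C.real_Iic_prod_univ hu).le) ?_
  have h : Iic u ×ˢ (univ : Set ℝ) ⊆ Iic u ×ˢ Iic 1 ∪ univ ×ˢ Ioi 1 := by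
    rintro ⟨x, y⟩ hx
    simp only [mem_union, mem_prod, mem_Iic, mem_univ, true_and, mem_Ioi, and_true] at hx ⊢
    rcases le_or_gt y 1 with h | h
    · exact Or.inl ⟨hx, h⟩
    · exact Or.inr h
  have h1 := (measureReal_mono (μ := C.law) h).trans (measureReal_union_le _ _)
  rw [C.real_Iic_prod_univ hu, C.real_univ_prod_Ioi, add_zero] at h1
  exact h1

theorem real_Ioc_prod_Iic (C : Copula) {a b : ℝ} (hab : a ≤ b) (v : ℝ) :
    C.law.real (Ioc a b ×ˢ Iic v) = C.cdf b v - C.cdf a v := by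
  have h : Iic b ×ˢ Iic v = Iic a ×ˢ Iic v ∪ Ioc a b ×ˢ Iic v := by
    rw [← union_prod, Iic_union_Ioc_eq_Iic hab]
  have hd : Disjoint (Iic a ×ˢ Iic v) (Ioc a b ×ˢ Iic v) :=
    (Iic_disjoint_Ioc le_rfl).set_prod_left _ _
  rw [cdf, h, measureReal_union hd (measurableSet_Ioc.prod measurableSet_Iic), cdf]
  ring

/-- The mass that the distribution function of `C` gives to a rectangle. -/
def rectMass (C : Copula) (a b c d : ℝ) : ℝ :=
  C.cdf b d - C.cdf a d - (C.cdf b c - C.cdf a c)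

theorem real_Ioc_prod_Ioc (C : Copula) {a b c d : ℝ} (hab : a ≤ b) (hcd : c ≤ d) :
    C.law.real (Ioc a b ×ˢ Ioc c d) = C.rectMass a b c d := by
  have h : Ioc a b ×ˢ Iic d = Ioc a b ×ˢ Iic c ∪ Ioc a b ×ˢ Ioc c d := by
    rw [← prod_union, Iic_union_Ioc_eq_Iic hcd]
  have hd : Disjoint (Ioc a b ×ˢ Iic c) (Ioc a b ×ˢ Ioc c d) :=
    (Iic_disjoint_Ioc le_rfl).set_prod_right _ _
  have h1 := measureReal_union (μ := C.law) hd (measurableSet_Ioc.prod measurableSet_Ioc)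
  rw [← h, C.real_Ioc_prod_Iic hab, C.real_Ioc_prod_Iic hab] at h1
  rw [rectMass]
  linarith

theorem abs_cdf_sub_left_le (C : Copula) (u u' v : ℝ) : |C.cdf u v - C.cdf u' v| ≤ |u - u'| := by
  wlog h : u' ≤ u generalizing u u'
  · rw [abs_sub_comm, abs_sub_comm u]; exact this u' u (le_of_not_ge h)
  rw [abs_of_nonneg (sub_nonneg.2 (C.cdf_mono_left h v)), abs_of_nonneg (sub_nonneg.2 h),
    ← C.real_Ioc_prod_Iic h]
  have h1 : C.law (Ioc u' u ×ˢ Iic v) ≤ ENNReal.ofReal (u - u') := by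
    calc C.law (Ioc u' u ×ˢ Iic v) ≤ C.law (Ioc u' u ×ˢ univ) :=
          measure_mono (prod_mono_right (subset_univ _))
      _ = (volume.restrict (Icc 0 1)) (Ioc u' u) := by
          rw [prod_univ, ← Measure.fst_apply measurableSet_Ioc, C.fst_law]
      _ ≤ volume (Ioc u' u) := Measure.restrict_apply_le _ _
      _ = _ := Real.volume_Ioc
  exact ENNReal.toReal_le_of_le_ofReal (sub_nonneg.2 h) h1

theorem continuous_cdf (C : Copula) : Continuous fun p : ℝ × ℝ => C.cdf p.1 p.2 := by
  rw [continuous_iff_continuousAt]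
  rintro ⟨u, v⟩
  rw [ContinuousAt, tendsto_iff_dist_tendsto_zero]
  have h0 : Tendsto (fun p : ℝ × ℝ => |p.1 - u| + |p.2 - v|) (𝓝 (u, v)) (𝓝 0) := by
    have : Continuous fun p : ℝ × ℝ => |p.1 - u| + |p.2 - v| := by fun_prop
    have := this.tendsto (u, v)
    simpa using this
  refine squeeze_zero (fun _ => dist_nonneg) (fun p => ?_) h0
  rw [Real.dist_eq]
  have h1 := C.abs_cdf_sub_left_le p.1 u p.2
  have h2 := C.swap.abs_cdf_sub_left_le p.2 v u
  rw [cdf_swap, cdf_swap] at h2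
  calc |C.cdf p.1 p.2 - C.cdf u v| ≤ |C.cdf p.1 p.2 - C.cdf u p.2| + |C.cdf u p.2 - C.cdf u v| :=
        abs_sub_le _ _ _
    _ ≤ _ := add_le_add h1 h2

end Copula

theorem isSupermodular_indicator_Iic_prod (u v : ℝ) :
    IsSupermodular ((Iic u ×ˢ Iic v).indicator fun _ => (1 : ℝ)) := by
  rintro ⟨x, y⟩ ⟨x', y'⟩
  simp only [indicator, mem_prod, mem_Iic, Prod.mk_sup_mk, Prod.mk_inf_mk, sup_le_iff, inf_le_iff]
  by_cases h1 : x ≤ u <;> by_cases h2 : y ≤ v <;> by_cases h3 : x' ≤ u <;>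
    by_cases h4 : y' ≤ v <;> simp [h1, h2, h3, h4]

/-- Indicators of lower quadrants are supermodular; this pointwise order of distribution functions
is all that the comparison needs. -/
theorem SMOrder.cdf_le {C C' : Copula} (h : SMOrder C.law C'.law) (u v : ℝ) :
    C.cdf u v ≤ C'.cdf u v := by
  have hm : MeasurableSet (Iic u ×ˢ Iic v) := measurableSet_Iic.prod measurableSet_Iic
  have hi : ∀ D : Copula, Integrable ((Iic u ×ˢ Iic v).indicator fun _ => (1 : ℝ)) D.law :=
    fun D => (integrable_const 1).indicator hm
  have := h _ (isSupermodular_indicator_Iic_prod u v) (hi C) (hi C')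
  rwa [integral_indicator_const _ hm, integral_indicator_const _ hm, smul_eq_mul, smul_eq_mul,
    mul_one, mul_one] at this

/-! ### The divergence of a copula and its discretization -/

namespace Copula

/-- The Kullback-Leibler divergence of an absolutely continuous copula from independence. -/
def divergence (C : Copula) : ENNReal :=
  ∫⁻ p in Icc (0 : ℝ) 1 ×ˢ Icc (0 : ℝ) 1, ENNReal.ofReal (InformationTheory.klFun (C.density p))

theorem density_nonneg (C : Copula) (p : ℝ × ℝ) : 0 ≤ C.density p := ENNReal.toReal_nonneg

theorem measurable_density (C : Copula) : Measurable C.density :=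
  (Measure.measurable_rnDeriv _ _).ennreal_toReal

/-- The average of the copula density over a cell of the regular `n × n` grid. -/
def gridDensity (C : Copula) (n i j : ℕ) : ℝ :=
  (n : ℝ) ^ 2 * C.rectMass (i / n) ((i + 1) / n) (j / n) ((j + 1) / n)

/-- The divergence of the discretization of a copula on the regular `n × n` grid. -/
def gridDivergence (C : Copula) (n : ℕ) : ℝ :=
  (∑ i ∈ Finset.range n, ∑ j ∈ Finset.range n, InformationTheory.klFun (C.gridDensity n i j)) /
    (n : ℝ) ^ 2

theorem gridDensity_eq (C : Copula) (n i j : ℕ) :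
    C.gridDensity n i j = (n : ℝ) ^ 2 *
      C.law.real (Ioc (i / n : ℝ) ((i + 1) / n) ×ˢ Ioc (j / n : ℝ) ((j + 1) / n)) := by
  rw [C.real_Ioc_prod_Ioc (by gcongr; linarith) (by gcongr; linarith), gridDensity]

theorem gridDensity_nonneg (C : Copula) (n i j : ℕ) : 0 ≤ C.gridDensity n i j := by
  rw [gridDensity_eq]; positivity

theorem sum_gridDensity_right (C : Copula) (n i J : ℕ) :
    ∑ j ∈ Finset.range J, C.gridDensity n i j =
      (n : ℝ) ^ 2 * (C.cdf ((i + 1) / n) (J / n) - C.cdf (i / n) (J / n)) := by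
  have h := Finset.sum_range_sub
    (fun j : ℕ => C.cdf ((i + 1) / n) (j / n) - C.cdf (i / n) (j / n)) J
  simp only [Nat.cast_zero, zero_div, cdf_zero_right, sub_zero] at h
  rw [← h, Finset.mul_sum]
  exact Finset.sum_congr rfl fun j _ => by simp [gridDensity, rectMass]

theorem sum_sum_gridDensity (C : Copula) (n I J : ℕ) :
    ∑ i ∈ Finset.range I, ∑ j ∈ Finset.range J, C.gridDensity n i j =
      (n : ℝ) ^ 2 * C.cdf (I / n) (J / n) := by
  have h := Finset.sum_range_sub (fun i : ℕ => C.cdf (i / n) (J / n)) I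
  simp only [Nat.cast_zero, zero_div, cdf_zero_left, sub_zero] at h
  rw [← h, Finset.mul_sum]
  exact Finset.sum_congr rfl fun j _ => by rw [sum_gridDensity_right]; simp

theorem div_mem_Icc {n i : ℕ} (hi : i ≤ n) : (i / n : ℝ) ∈ Icc (0 : ℝ) 1 :=
  ⟨by positivity, div_le_one_of_le₀ (by exact_mod_cast hi) (by positivity)⟩

theorem sum_gridDensity_row (C : Copula) {n i : ℕ} (hi : i < n) :
    ∑ j ∈ Finset.range n, C.gridDensity n i j = n := by
  have hn : (n : ℝ) ≠ 0 := by have : n ≠ 0 := by omega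
                              exact_mod_cast this
  have h := div_mem_Icc (Nat.succ_le_of_lt hi)
  push_cast at h
  rw [sum_gridDensity_right, div_self hn, cdf_one_right _ h,
    cdf_one_right _ (div_mem_Icc hi.le)]
  field_simp
  ring

theorem gridDensity_swap (C : Copula) (n i j : ℕ) :
    C.swap.gridDensity n i j = C.gridDensity n j i := by
  simp only [gridDensity, rectMass, cdf_swap]
  ring

theorem sum_gridDensity_col (C : Copula) {n j : ℕ} (hj : j < n) :
    ∑ i ∈ Finset.range n, C.gridDensity n i j = n := by
  rw [← C.swap.sum_gridDensity_row hj]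
  exact Finset.sum_congr rfl fun i _ => (C.gridDensity_swap n j i).symm

/-- The distribution of `C` on rectangles is totally positive of order two. -/
def RectTP2 (C : Copula) : Prop :=
  ∀ a b a' b' c d c' d' : ℝ, 0 ≤ a → a ≤ b → b ≤ a' → a' ≤ b' → b' ≤ 1 →
    0 ≤ c → c ≤ d → d ≤ c' → c' ≤ d' → d' ≤ 1 →
    C.rectMass a b c' d' * C.rectMass a' b' c d ≤ C.rectMass a b c d * C.rectMass a' b' c' d'

/-- The distribution of `C` on rectangles satisfies the reverse rule of order two. -/
def RectRR2 (C : Copula) : Prop :=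
  ∀ a b a' b' c d c' d' : ℝ, 0 ≤ a → a ≤ b → b ≤ a' → a' ≤ b' → b' ≤ 1 →
    0 ≤ c → c ≤ d → d ≤ c' → c' ≤ d' → d' ≤ 1 →
    C.rectMass a b c d * C.rectMass a' b' c' d' ≤ C.rectMass a b c' d' * C.rectMass a' b' c d

theorem succ_div_le_div {n i i' : ℕ} (h : i < i') : ((i + 1 : ℝ) / n) ≤ i' / n := by
  gcongr
  exact_mod_cast h

theorem succ_div_le_one {n i : ℕ} (h : i < n) : ((i + 1 : ℝ) / n) ≤ 1 := by
  have := (div_mem_Icc (Nat.succ_le_of_lt h)).2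
  push_cast at this
  exact this

theorem RectTP2.gridDensity {C : Copula} (h : C.RectTP2) {n i i' j j' : ℕ}
    (hi : i < i') (hi' : i' < n) (hj : j < j') (hj' : j' < n) :
    C.gridDensity n i j' * C.gridDensity n i' j ≤ C.gridDensity n i j * C.gridDensity n i' j' := by
  have := h (i / n) ((i + 1) / n) (i' / n) ((i' + 1) / n) (j / n) ((j + 1) / n) (j' / n)
    ((j' + 1) / n) (by positivity) (by gcongr; linarith) (succ_div_le_div hi) (by gcongr; linarith)
    (succ_div_le_one hi') (by positivity) (by gcongr; linarith) (succ_div_le_div hj)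
    (by gcongr; linarith) (succ_div_le_one hj')
  have h2 := mul_le_mul_of_nonneg_left this (by positivity : (0 : ℝ) ≤ (n : ℝ) ^ 2 * (n : ℝ) ^ 2)
  simp only [Copula.gridDensity]
  linarith

theorem RectRR2.gridDensity {C : Copula} (h : C.RectRR2) {n i i' j j' : ℕ}
    (hi : i < i') (hi' : i' < n) (hj : j < j') (hj' : j' < n) :
    C.gridDensity n i j * C.gridDensity n i' j' ≤ C.gridDensity n i j' * C.gridDensity n i' j := by
  have := h (i / n) ((i + 1) / n) (i' / n) ((i' + 1) / n) (j / n) ((j + 1) / n) (j' / n)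
    ((j' + 1) / n) (by positivity) (by gcongr; linarith) (succ_div_le_div hi) (by gcongr; linarith)
    (succ_div_le_one hi') (by positivity) (by gcongr; linarith) (succ_div_le_div hj)
    (by gcongr; linarith) (succ_div_le_one hj')
  have h2 := mul_le_mul_of_nonneg_left this (by positivity : (0 : ℝ) ≤ (n : ℝ) ^ 2 * (n : ℝ) ^ 2)
  simp only [Copula.gridDensity]
  linarith

theorem gridDivergence_le_of_rectTP2 {C C' : Copula} (h : C.RectTP2)
    (hle : ∀ u v, C.cdf u v ≤ C'.cdf u v) (n : ℕ) : C.gridDivergence n ≤ C'.gridDivergence n := by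
  unfold gridDivergence
  refine div_le_div_of_nonneg_right ?_ (by positivity)
  have hpos : ∀ i < n, (0 : ℝ) < n := fun i hi => by exact_mod_cast (Nat.zero_le i).trans_lt hi
  refine sum_klFun_le_of_tp2 (fun i _ j _ => C.gridDensity_nonneg n i j)
    (fun i _ j _ => C'.gridDensity_nonneg n i j) ?_ ?_ ?_ ?_
    (fun i i' j j' hi hi' hj hj' => h.gridDensity hi hi' hj hj') ?_
  · intro i hi; rw [sum_gridDensity_row _ hi]; exact hpos i hi
  · intro i hi; rw [sum_gridDensity_col _ hi]; exact hpos i hi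
  · intro i hi; rw [sum_gridDensity_row _ hi, sum_gridDensity_row _ hi]
  · intro i hi; rw [sum_gridDensity_col _ hi, sum_gridDensity_col _ hi]
  · intro i _ j _
    rw [sum_sum_gridDensity, sum_sum_gridDensity]
    exact mul_le_mul_of_nonneg_left (hle _ _) (by positivity)

/-- The substitution `j ↦ n - 1 - j` turns RR2 into TP2. It also reverses the order: a cumulative
sum over reversed columns is the row total minus a multiple of the distribution function at the
complementary column. -/
theorem gridDivergence_le_of_rectRR2 {C C' : Copula} (h : C.RectRR2)
    (hle : ∀ u v, C'.cdf u v ≤ C.cdf u v) (n : ℕ) : C.gridDivergence n ≤ C'.gridDivergence n := by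
  unfold gridDivergence
  refine div_le_div_of_nonneg_right ?_ (by positivity)
  have hpos : ∀ i < n, (0 : ℝ) < n := fun i hi => by exact_mod_cast (Nat.zero_le i).trans_lt hi
  have hflip : ∀ f : ℕ → ℝ, ∑ j ∈ Finset.range n, f j = ∑ j ∈ Finset.range n, f (n - 1 - j) :=
    fun f => (Finset.sum_range_reflect f n).symm
  have hcum : ∀ D : Copula, ∀ i ≤ n, ∀ j ≤ n,
      ∑ k ∈ Finset.range i, ∑ l ∈ Finset.range j, D.gridDensity n k (n - 1 - l) =
        ∑ k ∈ Finset.range i, (n : ℝ) - (n : ℝ) ^ 2 * D.cdf (i / n) ((n - j : ℕ) / n) := by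
    intro D i hi j hj
    rw [← sum_sum_gridDensity, ← Finset.sum_sub_distrib]
    refine Finset.sum_congr rfl fun k hk => ?_
    rw [← D.sum_gridDensity_row ((Finset.mem_range.1 hk).trans_le hi), hflip,
      ← Finset.sum_range_add_sum_Ico _ hj]
    have : ∑ l ∈ Finset.Ico j n, D.gridDensity n k (n - 1 - l) =
        ∑ l ∈ Finset.range (n - j), D.gridDensity n k l := by
      rw [Finset.sum_Ico_eq_sum_range, ← Finset.sum_range_reflect]
      refine Finset.sum_congr rfl fun l hl => ?_
      have := Finset.mem_range.1 hl
      congr 1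
      omega
    rw [this]
    ring
  have hkl : ∀ D : Copula,
      ∑ i ∈ Finset.range n, ∑ j ∈ Finset.range n, InformationTheory.klFun (D.gridDensity n i j) =
        ∑ i ∈ Finset.range n, ∑ j ∈ Finset.range n,
          InformationTheory.klFun (D.gridDensity n i (n - 1 - j)) :=
    fun D => Finset.sum_congr rfl fun i _ => hflip _
  rw [hkl C, hkl C']
  refine sum_klFun_le_of_tp2 (a := fun i j => C.gridDensity n i (n - 1 - j))
    (b := fun i j => C'.gridDensity n i (n - 1 - j)) (fun i _ j _ => C.gridDensity_nonneg n i _)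
    (fun i _ j _ => C'.gridDensity_nonneg n i _) ?_ ?_ ?_ ?_ ?_ ?_
  · intro i hi; rw [← hflip (fun j => C.gridDensity n i j), sum_gridDensity_row _ hi]
    exact hpos i hi
  · intro i hi; rw [sum_gridDensity_col _ (by omega)]; exact hpos i hi
  · intro i hi; rw [← hflip (fun j => C.gridDensity n i j), ← hflip (fun j => C'.gridDensity n i j),
      sum_gridDensity_row _ hi, sum_gridDensity_row _ hi]
  · intro i hi; rw [sum_gridDensity_col _ (by omega), sum_gridDensity_col _ (by omega)]
  · intro i i' j j' hi hi' hj hj'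
    exact h.gridDensity hi hi' (by omega) (by omega)
  · intro i hi j hj
    rw [hcum C i hi j hj, hcum C' i hi j hj]
    exact sub_le_sub_left (mul_le_mul_of_nonneg_left (hle _ _) (by positivity)) _

end Copula

/-! ### Recovering the divergence from its discretizations -/

namespace Copula

theorem AbsCont.withDensity_density {C : Copula} (h : C.AbsCont) :
    (volume : Measure (ℝ × ℝ)).withDensity (fun p => ENNReal.ofReal (C.density p)) = C.law := by
  rw [← Measure.withDensity_rnDeriv_eq C.law volume h]
  refine withDensity_congr_ae ?_
  filter_upwards [Measure.rnDeriv_lt_top C.law volume] with p hp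
  rw [density, ENNReal.ofReal_toReal hp.ne]

theorem integrable_density (C : Copula) : Integrable C.density volume :=
  Measure.integrable_toReal_rnDeriv

theorem AbsCont.setIntegral_density {C : Copula} (h : C.AbsCont) (s : Set (ℝ × ℝ)) :
    ∫ p in s, C.density p = C.law.real s :=
  Measure.setIntegral_toReal_rnDeriv h s

theorem volume_prod_Ioc_grid {n : ℕ} (hn : n ≠ 0) (i j : ℕ) :
    (volume : Measure (ℝ × ℝ)) (Ioc (i / n : ℝ) ((i + 1) / n) ×ˢ Ioc (j / n : ℝ) ((j + 1) / n)) =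
      ENNReal.ofReal (((n : ℝ) ^ 2)⁻¹) := by
  have hn' : (n : ℝ) ≠ 0 := by exact_mod_cast hn
  rw [Measure.volume_eq_prod, Measure.prod_prod, Real.volume_Ioc, Real.volume_Ioc,
    ← ENNReal.ofReal_mul (by rw [← sub_div]; simp)]
  congr 1
  field_simp
  ring

theorem biUnion_grid_eq {n : ℕ} (hn : n ≠ 0) :
    (⋃ q ∈ Finset.range n ×ˢ Finset.range n,
      Ioc (q.1 / n : ℝ) ((q.1 + 1) / n) ×ˢ Ioc (q.2 / n : ℝ) ((q.2 + 1) / n)) =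
      Ioc (0 : ℝ) 1 ×ˢ Ioc (0 : ℝ) 1 := by
  have hn' : (0 : ℝ) < n := by exact_mod_cast Nat.pos_of_ne_zero hn
  -- The cells are open on the left, so the index is `⌈n x⌉₊ - 1`, which involves no truncated
  -- subtraction since `x > 0`.
  have key : ∀ x ∈ Ioc (0 : ℝ) 1, ∃ i < n, x ∈ Ioc (i / n : ℝ) ((i + 1) / n) := by
    intro x hx
    have h0 : 0 < ⌈(n : ℝ) * x⌉₊ := Nat.ceil_pos.2 (mul_pos hn' hx.1)
    have h1 : ⌈(n : ℝ) * x⌉₊ ≤ n := Nat.ceil_le.2 (by nlinarith [hx.2])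
    obtain ⟨i, hi⟩ : ∃ i, ⌈(n : ℝ) * x⌉₊ = i + 1 := ⟨_, (Nat.succ_pred_eq_of_pos h0).symm⟩
    refine ⟨i, by omega, ?_, ?_⟩
    · rw [div_lt_iff₀ hn', mul_comm]
      exact Nat.lt_ceil.1 (by omega)
    · rw [le_div_iff₀ hn', mul_comm]
      have := Nat.ceil_le.1 hi.le
      exact_mod_cast this
  ext ⟨x, y⟩
  simp only [mem_iUnion, Finset.mem_product, Finset.mem_range, exists_prop]
  constructor
  · rintro ⟨⟨i, j⟩, ⟨hi, hj⟩, hx, hy⟩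
    have hi0 : (0 : ℝ) ≤ i / n := by positivity
    have hj0 : (0 : ℝ) ≤ j / n := by positivity
    exact ⟨⟨hi0.trans_lt hx.1, hx.2.trans (succ_div_le_one hi)⟩,
      ⟨hj0.trans_lt hy.1, hy.2.trans (succ_div_le_one hj)⟩⟩
  · rintro ⟨hx, hy⟩
    obtain ⟨i, hi, hxi⟩ := key x hx
    obtain ⟨j, hj, hyj⟩ := key y hy
    exact ⟨(i, j), ⟨hi, hj⟩, hxi, hyj⟩

theorem eq_of_mem_Ioc_grid {n i j : ℕ} {x : ℝ} (hi : x ∈ Ioc (i / n : ℝ) ((i + 1) / n))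
    (hj : x ∈ Ioc (j / n : ℝ) ((j + 1) / n)) : i = j := by
  by_contra hne
  rcases lt_or_gt_of_ne hne with h | h
  · have := succ_div_le_div (n := n) h
    linarith [hi.2, hj.1]
  · have := succ_div_le_div (n := n) h
    linarith [hj.2, hi.1]

theorem lintegral_square_eq_sum {n : ℕ} (hn : n ≠ 0) (f : ℝ × ℝ → ENNReal) :
    ∫⁻ p in Icc (0 : ℝ) 1 ×ˢ Icc (0 : ℝ) 1, f p =
      ∑ i ∈ Finset.range n, ∑ j ∈ Finset.range n,
        ∫⁻ p in Ioc (i / n : ℝ) ((i + 1) / n) ×ˢ Ioc (j / n : ℝ) ((j + 1) / n), f p := by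
  have h : (Icc (0 : ℝ) 1 ×ˢ Icc (0 : ℝ) 1 : Set (ℝ × ℝ)) =ᵐ[volume]
      (Ioc (0 : ℝ) 1 ×ˢ Ioc (0 : ℝ) 1 : Set (ℝ × ℝ)) :=
    Measure.set_prod_ae_eq Ioc_ae_eq_Icc.symm Ioc_ae_eq_Icc.symm
  rw [setLIntegral_congr h, ← biUnion_grid_eq hn, lintegral_biUnion_finset, Finset.sum_product]
  · rintro ⟨i, j⟩ _ ⟨i', j'⟩ _ hne
    refine Set.disjoint_left.2 ?_
    rintro ⟨x, y⟩ ⟨hx, hy⟩ ⟨hx', hy'⟩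
    exact hne (Prod.ext (eq_of_mem_Ioc_grid hx hx') (eq_of_mem_Ioc_grid hy hy'))
  · exact fun q _ => measurableSet_Ioc.prod measurableSet_Ioc

/-- Discretization decreases the divergence. -/
theorem AbsCont.ofReal_gridDivergence_le {C : Copula} (h : C.AbsCont) {n : ℕ} (hn : n ≠ 0) :
    ENNReal.ofReal (C.gridDivergence n) ≤ C.divergence := by
  have hn' : (n : ℝ) ≠ 0 := by exact_mod_cast hn
  rw [divergence, lintegral_square_eq_sum hn, gridDivergence, Finset.sum_div]
  rw [ENNReal.ofReal_sum_of_nonneg fun i _ => div_nonneg (Finset.sum_nonneg fun j _ =>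
    InformationTheory.klFun_nonneg (C.gridDensity_nonneg n i j)) (by positivity)]
  refine Finset.sum_le_sum fun i _ => ?_
  rw [Finset.sum_div, ENNReal.ofReal_sum_of_nonneg fun j _ => div_nonneg
    (InformationTheory.klFun_nonneg (C.gridDensity_nonneg n i j)) (by positivity)]
  refine Finset.sum_le_sum fun j _ => ?_
  set Q := Ioc (i / n : ℝ) ((i + 1) / n) ×ˢ Ioc (j / n : ℝ) ((j + 1) / n) with hQ
  have hvol := volume_prod_Ioc_grid hn i j
  rw [← hQ] at hvol
  by_cases htop : ∫⁻ p in Q, ENNReal.ofReal (InformationTheory.klFun (C.density p)) = ⊤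
  · rw [htop]; exact le_top
  have hnn : ∀ p, 0 ≤ InformationTheory.klFun (C.density p) := fun p =>
    InformationTheory.klFun_nonneg (C.density_nonneg p)
  have hmeas : Measurable fun p => InformationTheory.klFun (C.density p) :=
    InformationTheory.measurable_klFun.comp C.measurable_density
  have hint : IntegrableOn (fun p => InformationTheory.klFun (C.density p)) Q := by
    refine ⟨hmeas.aestronglyMeasurable, ?_⟩
    rw [hasFiniteIntegral_iff_ofReal (Eventually.of_forall hnn)]
    exact lt_top_iff_ne_top.2 htop
  have hpos : 0 < ((n : ℝ) ^ 2)⁻¹ := by positivity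
  -- Jensen's inequality on one cell, where the average of the density is exactly the grid density.
  have hj := InformationTheory.convexOn_klFun.map_set_average_le (μ := volume) (t := Q)
    (f := C.density) InformationTheory.continuous_klFun.continuousOn isClosed_Ici
    (by rw [hvol]; simpa using hn) (by rw [hvol]; exact ENNReal.ofReal_ne_top)
    (Eventually.of_forall C.density_nonneg) C.integrable_density.integrableOn hint
  rw [setAverage_eq, setAverage_eq, h.setIntegral_density, measureReal_def, hvol,
    ENNReal.toReal_ofReal hpos.le, inv_inv, smul_eq_mul, smul_eq_mul, hQ, ← C.gridDensity_eq,
    ← hQ] at hj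
  rw [← ofReal_integral_eq_lintegral_ofReal hint (Eventually.of_forall hnn)]
  refine ENNReal.ofReal_le_ofReal ?_
  rw [div_le_iff₀ (by positivity)]
  linarith

/-- Lebesgue differentiation along the cells that contain `p`. These are not centred at `p`, so the
Vitali family of a doubling measure is used, which admits balls merely containing the point. -/
theorem AbsCont.ae_tendsto_gridDensity {C : Copula} (h : C.AbsCont) :
    ∀ᵐ p ∂(volume : Measure (ℝ × ℝ)), p ∈ Ioc (0 : ℝ) 1 ×ˢ Ioc (0 : ℝ) 1 →
      Tendsto (fun n : ℕ => C.gridDensity (n + 1) (⌈((n + 1 : ℕ) : ℝ) * p.1⌉₊ - 1)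
        (⌈((n + 1 : ℕ) : ℝ) * p.2⌉₊ - 1)) atTop (𝓝 (C.density p)) := by
  filter_upwards [VitaliFamily.ae_tendsto_rnDeriv
    (IsUnifLocDoublingMeasure.vitaliFamily (volume : Measure (ℝ × ℝ)) 1) C.law,
    Measure.rnDeriv_lt_top C.law volume] with p hp hfin hmem
  obtain ⟨x, y⟩ := p
  have hcell : ∀ (n : ℕ) (z : ℝ), z ∈ Ioc (0 : ℝ) 1 →
      z ∈ Icc (((⌈((n + 1 : ℕ) : ℝ) * z⌉₊ - 1 : ℕ) : ℝ) / (n + 1 : ℕ))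
        ((((⌈((n + 1 : ℕ) : ℝ) * z⌉₊ - 1 : ℕ) : ℝ) + 1) / (n + 1 : ℕ)) := by
    intro n z hz
    have hn' : (0 : ℝ) < (n + 1 : ℕ) := by positivity
    have h0 : 0 < ⌈((n + 1 : ℕ) : ℝ) * z⌉₊ := Nat.ceil_pos.2 (mul_pos hn' hz.1)
    obtain ⟨i, hi⟩ : ∃ i, ⌈((n + 1 : ℕ) : ℝ) * z⌉₊ = i + 1 :=
      ⟨_, (Nat.succ_pred_eq_of_pos h0).symm⟩
    rw [hi, Nat.add_sub_cancel]
    constructor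
    · rw [div_le_iff₀ hn', mul_comm]
      exact (Nat.lt_ceil.1 (by omega)).le
    · rw [le_div_iff₀ hn', mul_comm]
      have := Nat.ceil_le.1 hi.le
      exact_mod_cast this
  -- In the sup norm a closed cell is the ball of radius `1 / (2 (n + 1))` about its midpoint.
  let ctr : ℕ → ℝ → ℝ := fun n z =>
    (((⌈((n + 1 : ℕ) : ℝ) * z⌉₊ - 1 : ℕ) : ℝ) + 1 / 2) / (n + 1 : ℕ)
  let δ : ℕ → ℝ := fun n => 1 / 2 / (n + 1 : ℕ)
  have hball : ∀ n z, Metric.closedBall (ctr n z) (δ n) =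
      Icc (((⌈((n + 1 : ℕ) : ℝ) * z⌉₊ - 1 : ℕ) : ℝ) / (n + 1 : ℕ))
        ((((⌈((n + 1 : ℕ) : ℝ) * z⌉₊ - 1 : ℕ) : ℝ) + 1) / (n + 1 : ℕ)) := by
    intro n z
    rw [Real.closedBall_eq_Icc]
    congr 1 <;> simp only [ctr, δ] <;> ring
  have hδ : Tendsto δ atTop (𝓝[>] 0) := by
    refine tendsto_nhdsWithin_iff.2 ⟨?_, Eventually.of_forall fun n => ?_⟩
    · exact (tendsto_const_div_atTop_nhds_zero_nat (1 / 2 : ℝ)).comp (tendsto_add_atTop_nat 1)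
    · simp only [δ, mem_Ioi]; positivity
  have hlim := hp.comp (IsUnifLocDoublingMeasure.tendsto_closedBall_filterAt volume
    (K := 1) (x := (x, y)) (fun n => (ctr n x, ctr n y)) δ hδ (Eventually.of_forall fun n => by
      rw [one_mul, ← closedBall_prod_same, hball, hball]
      exact ⟨hcell n x hmem.1, hcell n y hmem.2⟩))
  have hlim' := (ENNReal.tendsto_toReal hfin.ne).comp hlim
  refine hlim'.congr fun n => ?_
  have hae : (Icc (((⌈((n + 1 : ℕ) : ℝ) * x⌉₊ - 1 : ℕ) : ℝ) / (n + 1 : ℕ))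
        ((((⌈((n + 1 : ℕ) : ℝ) * x⌉₊ - 1 : ℕ) : ℝ) + 1) / (n + 1 : ℕ)) ×ˢ
      Icc (((⌈((n + 1 : ℕ) : ℝ) * y⌉₊ - 1 : ℕ) : ℝ) / (n + 1 : ℕ))
        ((((⌈((n + 1 : ℕ) : ℝ) * y⌉₊ - 1 : ℕ) : ℝ) + 1) / (n + 1 : ℕ)) : Set (ℝ × ℝ))
      =ᵐ[volume]
      (Ioc (((⌈((n + 1 : ℕ) : ℝ) * x⌉₊ - 1 : ℕ) : ℝ) / (n + 1 : ℕ))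
        ((((⌈((n + 1 : ℕ) : ℝ) * x⌉₊ - 1 : ℕ) : ℝ) + 1) / (n + 1 : ℕ)) ×ˢ
      Ioc (((⌈((n + 1 : ℕ) : ℝ) * y⌉₊ - 1 : ℕ) : ℝ) / (n + 1 : ℕ))
        ((((⌈((n + 1 : ℕ) : ℝ) * y⌉₊ - 1 : ℕ) : ℝ) + 1) / (n + 1 : ℕ)) : Set (ℝ × ℝ)) :=
    Measure.set_prod_ae_eq Ioc_ae_eq_Icc.symm Ioc_ae_eq_Icc.symm
  simp only [Function.comp_apply]
  rw [← closedBall_prod_same, hball, hball, measure_congr hae, measure_congr (h.ae_eq hae), volume_prod_Ioc_grid (Nat.succ_ne_zero n), gridDensity_eq, ENNReal.toReal_div,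
    ENNReal.toReal_ofReal (by positivity), div_inv_eq_mul, mul_comm]
  rfl

/-- The divergence is at most any common bound of the divergences of the discretizations. -/
theorem AbsCont.divergence_le {C : Copula} (h : C.AbsCont) {B : ENNReal}
    (hB : ∀ n : ℕ, n ≠ 0 → ENNReal.ofReal (C.gridDivergence n) ≤ B) : C.divergence ≤ B := by
  let s : ℕ → ℝ × ℝ → ℝ := fun n p => C.gridDensity (n + 1) (⌈((n + 1 : ℕ) : ℝ) * p.1⌉₊ - 1)
        (⌈((n + 1 : ℕ) : ℝ) * p.2⌉₊ - 1)
  have hs : ∀ n, Measurable (s n) := by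
    intro n
    have h1 : Measurable fun p : ℝ × ℝ => ⌈((n + 1 : ℕ) : ℝ) * p.1⌉₊ :=
      (measurable_fst.const_mul _).nat_ceil
    have h2 : Measurable fun p : ℝ × ℝ => ⌈((n + 1 : ℕ) : ℝ) * p.2⌉₊ :=
      (measurable_snd.const_mul _).nat_ceil
    -- The step function factors through a pair of indices in a countable space, on which every
    -- function is measurable.
    have hG : Measurable fun q : ℕ × ℕ => C.gridDensity (n + 1) (q.1 - 1) (q.2 - 1) :=
      measurable_of_countable _
    have h3 := hG.comp (h1.prodMk h2)
    simpa only [Function.comp_def] using h3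
  have hf : ∀ n, Measurable fun p => ENNReal.ofReal (InformationTheory.klFun (s n p)) := fun n =>
    (InformationTheory.measurable_klFun.comp (hs n)).ennreal_ofReal
  have hsq : (Icc (0 : ℝ) 1 ×ˢ Icc (0 : ℝ) 1 : Set (ℝ × ℝ)) =ᵐ[volume]
      (Ioc (0 : ℝ) 1 ×ˢ Ioc (0 : ℝ) 1 : Set (ℝ × ℝ)) :=
    Measure.set_prod_ae_eq Ioc_ae_eq_Icc.symm Ioc_ae_eq_Icc.symm
  have hval : ∀ n, ∫⁻ p in Icc (0 : ℝ) 1 ×ˢ Icc (0 : ℝ) 1,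
      ENNReal.ofReal (InformationTheory.klFun (s n p)) =
        ENNReal.ofReal (C.gridDivergence (n + 1)) := by
    intro n
    have hn' : (0 : ℝ) < (n + 1 : ℕ) := by positivity
    rw [lintegral_square_eq_sum (Nat.succ_ne_zero n), gridDivergence, Finset.sum_div,
      ENNReal.ofReal_sum_of_nonneg fun i _ => div_nonneg (Finset.sum_nonneg fun j _ =>
      InformationTheory.klFun_nonneg (C.gridDensity_nonneg _ i j)) (by positivity)]
    refine Finset.sum_congr rfl fun i _ => ?_
    rw [Finset.sum_div, ENNReal.ofReal_sum_of_nonneg fun j _ => div_nonneg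
      (InformationTheory.klFun_nonneg (C.gridDensity_nonneg _ i j)) (by positivity)]
    refine Finset.sum_congr rfl fun j _ => ?_
    have hc : ∀ (k : ℕ) (z : ℝ), z ∈ Ioc ((k : ℝ) / (n + 1 : ℕ)) ((k + 1) / (n + 1 : ℕ)) →
        ⌈((n + 1 : ℕ) : ℝ) * z⌉₊ - 1 = k := by
      intro k z hz
      rw [mem_Ioc, div_lt_iff₀ hn', le_div_iff₀ hn'] at hz
      have : ⌈((n + 1 : ℕ) : ℝ) * z⌉₊ = k + 1 := by
        rw [Nat.ceil_eq_iff (Nat.succ_ne_zero k)]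
        push_cast at hz ⊢
        constructor <;> linarith [hz.1, hz.2]
      omega
    rw [setLIntegral_congr_fun (g := fun _ => ENNReal.ofReal (InformationTheory.klFun
      (C.gridDensity (n + 1) i j))) (measurableSet_Ioc.prod measurableSet_Ioc),
      setLIntegral_const, volume_prod_Ioc_grid (Nat.succ_ne_zero n), ← ENNReal.ofReal_mul
      (InformationTheory.klFun_nonneg (C.gridDensity_nonneg _ i j)), div_eq_mul_inv]
    rintro ⟨x, y⟩ ⟨hx, hy⟩
    simp only [s]
    rw [hc i x hx, hc j y hy]
  -- Fatou's lemma for the step functions, whose integrals are the grid divergences.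
  calc C.divergence = ∫⁻ p in Icc (0 : ℝ) 1 ×ˢ Icc (0 : ℝ) 1,
        liminf (fun n => ENNReal.ofReal (InformationTheory.klFun (s n p))) atTop := by
        rw [divergence, setLIntegral_congr hsq, setLIntegral_congr hsq]
        refine setLIntegral_congr_fun_ae (measurableSet_Ioc.prod measurableSet_Ioc) ?_
        filter_upwards [h.ae_tendsto_gridDensity] with p hp hmem
        exact (((ENNReal.continuous_ofReal.comp
          InformationTheory.continuous_klFun).tendsto _).comp (hp hmem)).liminf_eq.symm
    _ ≤ liminf (fun n => ∫⁻ p in Icc (0 : ℝ) 1 ×ˢ Icc (0 : ℝ) 1,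
        ENNReal.ofReal (InformationTheory.klFun (s n p))) atTop := lintegral_liminf_le hf
    _ ≤ liminf (fun _ : ℕ => B) atTop := by
        refine liminf_le_liminf (Eventually.of_forall fun n => ?_)
        rw [hval]
        exact hB _ (Nat.succ_ne_zero n)
    _ = B := liminf_const _

theorem divergence_le_of_rectTP2 {C C' : Copula} (hC : C.AbsCont) (hC' : C'.AbsCont)
    (h : C.RectTP2) (hle : SMOrder C.law C'.law) : C.divergence ≤ C'.divergence :=
  hC.divergence_le fun n hn => (ENNReal.ofReal_le_ofReal
    (gridDivergence_le_of_rectTP2 h hle.cdf_le n)).trans (hC'.ofReal_gridDivergence_le hn)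

theorem divergence_le_of_rectRR2 {C C' : Copula} (hC : C.AbsCont) (hC' : C'.AbsCont)
    (h : C.RectRR2) (hle : SMOrder C'.law C.law) : C.divergence ≤ C'.divergence :=
  hC.divergence_le fun n hn => (ENNReal.ofReal_le_ofReal
    (gridDivergence_le_of_rectRR2 h hle.cdf_le n)).trans (hC'.ofReal_gridDivergence_le hn)

end Copula

/-! ### Copulas with a TP2 or RR2 density -/

theorem setLIntegral_mul_setLIntegral_le {α β : Type*} [MeasurableSpace α] [MeasurableSpace β]
    {μ : Measure α} {ν : Measure β} {S : Set α} {T : Set β} (hS : MeasurableSet S)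
    (hT : MeasurableSet T) {u u' : α → ENNReal} {v v' : β → ENNReal} (hu : Measurable u)
    (hu' : Measurable u') (hv : Measurable v) (hv' : Measurable v')
    (h : ∀ s ∈ S, ∀ t ∈ T, u s * v t ≤ u' s * v' t) :
    (∫⁻ s in S, u s ∂μ) * ∫⁻ t in T, v t ∂ν ≤ (∫⁻ s in S, u' s ∂μ) * ∫⁻ t in T, v' t ∂ν := by
  rw [← lintegral_mul_const _ hu, ← lintegral_mul_const _ hu']
  refine setLIntegral_mono' hS fun s hs => ?_
  rw [← lintegral_const_mul _ hv, ← lintegral_const_mul _ hv']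
  exact setLIntegral_mono' hT fun t ht => h s hs t ht

/-- The four-point inequality is integrated over the second coordinates with `x, x'` fixed, then
over the first ones. The relative position of the sets plays no role, so exchanging `B` and `B'`
serves the RR2 case. -/
theorem setLIntegral_prod_mul_le {f : ℝ × ℝ → ENNReal} (hf : Measurable f) {A A' B B' : Set ℝ}
    (hA : MeasurableSet A) (hA' : MeasurableSet A') (hB : MeasurableSet B)
    (hB' : MeasurableSet B')
    (h : ∀ x ∈ A, ∀ x' ∈ A', ∀ y ∈ B, ∀ y' ∈ B', f (x, y') * f (x', y) ≤ f (x, y) * f (x', y')) :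
    (∫⁻ p in A ×ˢ B', f p) * ∫⁻ p in A' ×ˢ B, f p ≤
      (∫⁻ p in A ×ˢ B, f p) * ∫⁻ p in A' ×ˢ B', f p := by
  have hx : ∀ x, Measurable fun y => f (x, y) := fun x => hf.comp measurable_prodMk_left
  simp only [Measure.volume_eq_prod]
  rw [setLIntegral_prod _ hf.aemeasurable, setLIntegral_prod _ hf.aemeasurable,
    setLIntegral_prod _ hf.aemeasurable, setLIntegral_prod _ hf.aemeasurable]
  refine setLIntegral_mul_setLIntegral_le hA hA' hf.lintegral_prod_right' hf.lintegral_prod_right'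
    hf.lintegral_prod_right' hf.lintegral_prod_right' fun x hxA x' hxA' => ?_
  rw [mul_comm (∫⁻ y in B, f (x, y))]
  refine setLIntegral_mul_setLIntegral_le hB' hB (hx x) (hx x') (hx x') (hx x)
    fun y' hy' y hy => ?_
  rw [mul_comm (f (x', y'))]
  exact h x hxA x' hxA' y hy y' hy'

namespace Copula

/-- Open intervals are used because the TP2 and RR2 conditions are only available on the open
square. -/
theorem IsDensity.rectMass_eq {C : Copula} {c : ℝ × ℝ → ℝ} (h : C.IsDensity c) {a b x y : ℝ}
    (ha : 0 ≤ a) (hab : a ≤ b) (hb : b ≤ 1) (hx : 0 ≤ x) (hxy : x ≤ y) (hy : y ≤ 1) :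
    C.rectMass a b x y = (∫⁻ p in Ioo a b ×ˢ Ioo x y, ENNReal.ofReal (c p)).toReal := by
  rw [← C.real_Ioc_prod_Ioc hab hxy, measureReal_def, h.law_eq,
    withDensity_apply _ (measurableSet_Ioc.prod measurableSet_Ioc),
    Measure.restrict_restrict (measurableSet_Ioc.prod measurableSet_Ioc), inter_eq_left.2]
  · congr 1
    exact setLIntegral_congr (Measure.set_prod_ae_eq Ioo_ae_eq_Ioc.symm Ioo_ae_eq_Ioc.symm)
  · exact prod_mono (fun z hz => ⟨ha.trans hz.1.le, hz.2.trans hb⟩)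
      (fun z hz => ⟨hx.trans hz.1.le, hz.2.trans hy⟩)

theorem IsDensity.setLIntegral_ne_top {C : Copula} {c : ℝ × ℝ → ℝ} (h : C.IsDensity c)
    {a b x y : ℝ} (ha : 0 ≤ a) (hb : b ≤ 1) (hx : 0 ≤ x) (hy : y ≤ 1) :
    ∫⁻ p in Ioo a b ×ˢ Ioo x y, ENNReal.ofReal (c p) ≠ ⊤ := by
  have h1 : C.law (Ioo a b ×ˢ Ioo x y) ≠ ⊤ := measure_ne_top _ _
  rw [h.law_eq, withDensity_apply _ (measurableSet_Ioo.prod measurableSet_Ioo),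
    Measure.restrict_restrict (measurableSet_Ioo.prod measurableSet_Ioo), inter_eq_left.2] at h1
  · exact h1
  · exact prod_mono (fun z hz => ⟨ha.trans hz.1.le, hz.2.le.trans hb⟩)
      (fun z hz => ⟨hx.trans hz.1.le, hz.2.le.trans hy⟩)

theorem HasTP2Density.rectTP2 {C : Copula} (h : C.HasTP2Density) : C.RectTP2 := by
  obtain ⟨c, hc, htp⟩ := h
  intro a b a' b' x y x' y' ha hab hba hab' hb' hx hxy hyx hxy' hy'
  rw [hc.rectMass_eq ha hab (by linarith) (by linarith) hxy' hy',
    hc.rectMass_eq (by linarith) hab' hb' hx hxy (by linarith),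
    hc.rectMass_eq ha hab (by linarith) hx hxy (by linarith),
    hc.rectMass_eq (by linarith) hab' hb' (by linarith) hxy' hy', ← ENNReal.toReal_mul,
    ← ENNReal.toReal_mul]
  refine ENNReal.toReal_mono (ENNReal.mul_ne_top
    (hc.setLIntegral_ne_top ha (by linarith) hx (by linarith))
    (hc.setLIntegral_ne_top (by linarith) hb' (by linarith) hy')) ?_
  refine setLIntegral_prod_mul_le hc.measurable.ennreal_ofReal measurableSet_Ioo measurableSet_Ioo
    measurableSet_Ioo measurableSet_Ioo fun s hs s' hs' t ht t' ht' => ?_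
  rw [← ENNReal.ofReal_mul (hc.nonneg _), ← ENNReal.ofReal_mul (hc.nonneg _)]
  refine ENNReal.ofReal_le_ofReal ?_
  have hss : s ≤ s' := by linarith [hs.2, hs'.1]
  have htt : t ≤ t' := by linarith [ht.2, ht'.1]
  have := htp (s, t') ⟨⟨by linarith [hs.1], by linarith [hs.2]⟩,
    ⟨by linarith [ht'.1], by linarith [ht'.2]⟩⟩ (s', t) ⟨⟨by linarith [hs'.1], by linarith [hs'.2]⟩,
    ⟨by linarith [ht.1], by linarith [ht.2]⟩⟩
  rw [Prod.mk_sup_mk, Prod.mk_inf_mk, sup_eq_right.2 hss, sup_eq_left.2 htt, inf_eq_left.2 hss,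
    inf_eq_right.2 htt] at this
  linarith

theorem HasRR2Density.rectRR2 {C : Copula} (h : C.HasRR2Density) : C.RectRR2 := by
  obtain ⟨c, hc, htp⟩ := h
  intro a b a' b' x y x' y' ha hab hba hab' hb' hx hxy hyx hxy' hy'
  rw [hc.rectMass_eq ha hab (by linarith) (by linarith) hxy' hy',
    hc.rectMass_eq (by linarith) hab' hb' hx hxy (by linarith),
    hc.rectMass_eq ha hab (by linarith) hx hxy (by linarith),
    hc.rectMass_eq (by linarith) hab' hb' (by linarith) hxy' hy', ← ENNReal.toReal_mul,
    ← ENNReal.toReal_mul]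
  refine ENNReal.toReal_mono (ENNReal.mul_ne_top
    (hc.setLIntegral_ne_top ha (by linarith) (by linarith) hy')
    (hc.setLIntegral_ne_top (by linarith) hb' hx (by linarith))) ?_
  -- The two column intervals enter in exchanged order, which reverses the inequality obtained for
  -- TP2.
  refine setLIntegral_prod_mul_le hc.measurable.ennreal_ofReal measurableSet_Ioo measurableSet_Ioo
    measurableSet_Ioo measurableSet_Ioo fun s hs s' hs' t' ht' t ht => ?_
  rw [← ENNReal.ofReal_mul (hc.nonneg _), ← ENNReal.ofReal_mul (hc.nonneg _)]
  refine ENNReal.ofReal_le_ofReal ?_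
  have hss : s ≤ s' := by linarith [hs.2, hs'.1]
  have htt : t ≤ t' := by linarith [ht.2, ht'.1]
  have := htp (s, t') ⟨⟨by linarith [hs.1], by linarith [hs.2]⟩,
    ⟨by linarith [ht'.1], by linarith [ht'.2]⟩⟩ (s', t) ⟨⟨by linarith [hs'.1], by linarith [hs'.2]⟩,
    ⟨by linarith [ht.1], by linarith [ht.2]⟩⟩
  rw [Prod.mk_sup_mk, Prod.mk_inf_mk, sup_eq_right.2 hss, sup_eq_left.2 htt, inf_eq_left.2 hss,
    inf_eq_right.2 htt] at this
  linarith

end Copula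

/-! ### Completely monotone functions -/

theorem monotoneOn_Icc_of_hasDerivAt_nonneg {f f' : ℝ → ℝ} {a b : ℝ}
    (h : ∀ x ∈ Icc a b, HasDerivAt f (f' x) x) (h0 : ∀ x ∈ Icc a b, 0 ≤ f' x) :
    MonotoneOn f (Icc a b) :=
  monotoneOn_of_hasDerivWithinAt_nonneg (convex_Icc a b)
    (fun x hx => (h x hx).continuousAt.continuousWithinAt)
    (fun x hx => (h x (interior_subset hx)).hasDerivWithinAt)
    (fun x hx => h0 x (interior_subset hx))

theorem le_of_hasDerivAt_nonneg {f f' : ℝ → ℝ} {a b : ℝ} (hab : a ≤ b)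
    (h : ∀ x ∈ Icc a b, HasDerivAt f (f' x) x) (h0 : ∀ x ∈ Icc a b, 0 ≤ f' x) : f a ≤ f b :=
  monotoneOn_Icc_of_hasDerivAt_nonneg h h0 (left_mem_Icc.2 hab) (right_mem_Icc.2 hab) hab

/-- The pointwise inequality is integrated in each variable by monotonicity of a difference, so no
integrability of the derivatives is required. -/
theorem sub_mul_sub_le_of_hasDerivAt {U U' V V' u u' v v' : ℝ → ℝ} {a b c d : ℝ}
    (hab : a ≤ b) (hcd : c ≤ d)
    (hU : ∀ s ∈ Icc a b, HasDerivAt U (u s) s) (hU' : ∀ s ∈ Icc a b, HasDerivAt U' (u' s) s)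
    (hV : ∀ t ∈ Icc c d, HasDerivAt V (v t) t) (hV' : ∀ t ∈ Icc c d, HasDerivAt V' (v' t) t)
    (h : ∀ s ∈ Icc a b, ∀ t ∈ Icc c d, u s * v t ≤ u' s * v' t) :
    (U b - U a) * (V d - V c) ≤ (U' b - U' a) * (V' d - V' c) := by
  have h1 : ∀ t ∈ Icc c d, (U b - U a) * v t ≤ (U' b - U' a) * v' t := by
    intro t ht
    have := le_of_hasDerivAt_nonneg (f := fun s => U' s * v' t - U s * v t) hab
      (fun s hs => ((hU' s hs).mul_const _).sub ((hU s hs).mul_const _))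
      (fun s hs => sub_nonneg.2 (h s hs t ht))
    linarith
  have := le_of_hasDerivAt_nonneg
    (f := fun t => (U' b - U' a) * V' t - (U b - U a) * V t) hcd
    (fun t ht => ((hV' t ht).const_mul _).sub ((hV t ht).const_mul _))
    (fun t ht => sub_nonneg.2 (h1 t ht))
  linarith

/-- `F n` is `(-1)^n` times the `n`-th derivative of a completely monotone function `F 0`. -/
structure IsAlternatingDerivs (F : ℕ → ℝ → ℝ) : Prop where
  hasDerivAt : ∀ n x, 0 < x → HasDerivAt (F n) (-(F (n + 1) x)) x
  nonneg : ∀ n x, 0 < x → 0 ≤ F n x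

namespace IsAlternatingDerivs

variable {F : ℕ → ℝ → ℝ}

theorem shift (h : IsAlternatingDerivs F) (k : ℕ) : IsAlternatingDerivs fun n => F (n + k) where
  hasDerivAt n x hx := by
    have := h.hasDerivAt (n + k) x hx
    rwa [show n + k + 1 = n + 1 + k by ring] at this
  nonneg n x hx := h.nonneg _ x hx

theorem antitone (h : IsAlternatingDerivs F) (n : ℕ) {x y : ℝ} (hx : 0 < x) (hxy : x ≤ y) :
    F n y ≤ F n x := by
  have := le_of_hasDerivAt_nonneg (f := fun s => -F n s) hxy
    (fun s hs => (h.hasDerivAt n s (hx.trans_le hs.1)).neg)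
    (fun s hs => by rw [neg_neg]; exact h.nonneg _ s (hx.trans_le hs.1))
  linarith

/-- Since `F 1` decreases, `(x - 1) F 1 x ≤ F 0 1 - F 0 x ≤ F 0 1`. -/
theorem tendsto_one (h : IsAlternatingDerivs F) : Tendsto (F 1) atTop (𝓝 0) := by
  have h1 : ∀ x, 1 < x → F 1 x ≤ F 0 1 / (x - 1) := by
    intro x hx
    have := le_of_hasDerivAt_nonneg (f := fun s => -F 0 s - F 1 x * s) hx.le
      (fun s hs => ((h.hasDerivAt 0 s (by linarith [hs.1])).neg).sub
        ((hasDerivAt_id s).const_mul _))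
      (fun s hs => by
        have := h.antitone 1 (x := s) (y := x) (by linarith [hs.1]) hs.2
        simp only [zero_add, neg_neg, mul_one]
        linarith)
    have h0 := h.nonneg 0 x (by linarith)
    rw [le_div_iff₀ (by linarith)]
    linarith
  have h2 : Tendsto (fun x : ℝ => F 0 1 / (x - 1)) atTop (𝓝 0) :=
    (tendsto_atTop_add_const_right _ (-1) tendsto_id).const_div_atTop _
  refine squeeze_zero' ?_ ?_ h2
  · filter_upwards [eventually_gt_atTop 0] with x hx using h.nonneg 1 x hx
  · filter_upwards [eventually_gt_atTop 1] with x hx using h1 x hx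

/-- `(F 0)^(1 / (m + 1))` is convex for a completely monotone function `F 0`. -/
theorem mul_sq_le (m : ℕ) : ∀ {F : ℕ → ℝ → ℝ}, IsAlternatingDerivs F →
    (∀ n x, 0 < x → 0 < F n x) → ∀ x, 0 < x →
      (m : ℝ) * F 1 x ^ 2 ≤ (m + 1) * (F 0 x * F 2 x) := by
  induction m with
  | zero =>
    intro F h hpos x hx
    have := mul_pos (hpos 0 x hx) (hpos 2 x hx)
    simp only [Nat.cast_zero, zero_mul, zero_add, one_mul]
    exact this.le
  | succ m ih =>
    intro F h hpos x hx
    have ih' := fun y hy => ih (h.shift 1) (fun n => hpos (n + 1)) y hy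
    simp only [zero_add, one_add_one_eq_two, Nat.reduceAdd] at ih'
    -- With this exponent the `F 1 ^ 2 * F 2` terms in the derivative of `k * F 1 ^ (-r)` cancel.
    -- What remains is a positive multiple of `F 1 * F 3 - r * F 2 ^ 2`, nonnegative by the
    -- induction hypothesis for the shifted sequence.
    set r : ℝ := m / (m + 1) with hr
    have hm : (0 : ℝ) < m + 1 := by positivity
    have hr1 : r ≤ 1 := by rw [hr, div_le_one hm]; linarith
    let k : ℝ → ℝ := fun y => (m + 1) * F 1 y ^ 2 - (m + 2) * (F 0 y * F 2 y)
    have hk : ∀ y, 0 < y → HasDerivAt k ((m + 2) * (F 0 y * F 3 y) - m * (F 1 y * F 2 y)) y := by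
      intro y hy
      have := (((h.hasDerivAt 1 y hy).pow 2).const_mul ((m : ℝ) + 1)).sub
        (((h.hasDerivAt 0 y hy).mul (h.hasDerivAt 2 y hy)).const_mul ((m : ℝ) + 2))
      refine this.congr_deriv ?_
      simp only [zero_add, one_add_one_eq_two, Nat.reduceAdd, Nat.cast_ofNat, Nat.reduceSub, pow_one]
      ring
    have hG : ∀ y, 0 < y → HasDerivAt (fun y => k y * F 1 y ^ (-r))
        (((m + 2) * (F 0 y * F 3 y) - m * (F 1 y * F 2 y)) * F 1 y ^ (-r) +
          k y * (-(F 2 y) * (-r) * F 1 y ^ (-r - 1))) y := fun y hy =>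
      (hk y hy).mul ((h.hasDerivAt 1 y hy).rpow_const (Or.inl (hpos 1 y hy).ne'))
    have hG0 : ∀ y, 0 < y → 0 ≤ ((m + 2) * (F 0 y * F 3 y) - m * (F 1 y * F 2 y)) * F 1 y ^ (-r) +
          k y * (-(F 2 y) * (-r) * F 1 y ^ (-r - 1)) := by
      intro y hy
      have hw := hpos 1 y hy
      have e : F 1 y ^ (-r) = F 1 y * F 1 y ^ (-r - 1) := by
        rw [Real.rpow_sub_one hw.ne']; field_simp
      have hfac : ((m + 2) * (F 0 y * F 3 y) - m * (F 1 y * F 2 y)) * F 1 y ^ (-r) +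
          k y * (-(F 2 y) * (-r) * F 1 y ^ (-r - 1)) = F 1 y ^ (-r - 1) *
          (((m + 2) * (F 0 y * F 3 y) - m * (F 1 y * F 2 y)) * F 1 y + r * F 2 y * k y) := by
        rw [e]; ring
      rw [hfac]
      refine mul_nonneg (Real.rpow_nonneg hw.le _) ?_
      have hrm : r * (m + 1) = m := by rw [hr]; field_simp
      have h0 := hpos 0 y hy
      have hi := mul_le_mul_of_nonneg_left (ih' y hy)
        (by positivity : (0 : ℝ) ≤ ((m : ℝ) + 2) * F 0 y)
      refine nonneg_of_mul_nonneg_right (a := (m : ℝ) + 1) ?_ hm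
      have : ((m : ℝ) + 1) *
          (((m + 2) * (F 0 y * F 3 y) - m * (F 1 y * F 2 y)) * F 1 y + r * F 2 y * k y) =
          ((m : ℝ) + 1) * (((m + 2) * (F 0 y * F 3 y) - m * (F 1 y * F 2 y)) * F 1 y) +
            (r * (m + 1)) * F 2 y * k y := by ring
      rw [this, hrm]
      simp only [k]
      linarith
    -- The increasing function `k * F 1 ^ (-r)` is at most `(m + 1) * F 1 ^ (2 - r)`, which tends to
    -- zero because `2 - r > 0`. Hence it is nonpositive everywhere, and so is `k`.
    have hlim : Tendsto (fun y => ((m : ℝ) + 1) * F 1 y ^ (2 - r)) atTop (𝓝 0) := by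
      have := (h.tendsto_one.rpow_const (p := 2 - r) (Or.inr (by linarith))).const_mul ((m : ℝ) + 1)
      rwa [Real.zero_rpow (by linarith), mul_zero] at this
    have hle : k x * F 1 x ^ (-r) ≤ 0 := by
      refine ge_of_tendsto hlim ?_
      filter_upwards [eventually_ge_atTop x] with y hy
      have hy0 := hx.trans_le hy
      have hw := hpos 1 y hy0
      refine (le_of_hasDerivAt_nonneg hy (fun s hs => hG s (hx.trans_le hs.1))
        (fun s hs => hG0 s (hx.trans_le hs.1))).trans ?_
      have : F 1 y ^ (2 - r) = F 1 y ^ 2 * F 1 y ^ (-r) := by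
        rw [sub_eq_add_neg, Real.rpow_add hw, Real.rpow_two]
      rw [this, ← mul_assoc]
      refine mul_le_mul_of_nonneg_right ?_ (Real.rpow_nonneg hw.le _)
      have h0 := hpos 0 y hy0
      have h2 := hpos 2 y hy0
      have : 0 ≤ ((m : ℝ) + 2) * (F 0 y * F 2 y) := by positivity
      simp only [k]
      linarith
    have hkx : k x ≤ 0 := by
      by_contra hc
      exact absurd hle (not_le.2 (mul_pos (not_le.1 hc) (Real.rpow_pos_of_pos (hpos 1 x hx) _)))
    simp only [k] at hkx
    push_cast
    linarith

/-- Otherwise `m (F 1 ^ 2 - F 0 * F 2) ≤ F 0 * F 2` would fail for large `m`. -/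
theorem sq_le (h : IsAlternatingDerivs F) (hpos : ∀ n x, 0 < x → 0 < F n x) {x : ℝ} (hx : 0 < x) :
    F 1 x ^ 2 ≤ F 0 x * F 2 x := by
  by_contra hc
  obtain ⟨m, hm⟩ := exists_nat_gt (F 0 x * F 2 x / (F 1 x ^ 2 - F 0 x * F 2 x))
  have h1 := mul_sq_le m h hpos x hx
  rw [div_lt_iff₀ (by linarith)] at hm
  linarith

/-- By `sq_le` the quotient `F 1 / F 0`, minus the logarithmic derivative of `F 0`, is decreasing.
Therefore `t ↦ F 0 (t + s) / F 0 t` is increasing. -/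
theorem mul_le_mul_of_pos (h : IsAlternatingDerivs F) (hpos : ∀ n x, 0 < x → 0 < F n x)
    {a d s : ℝ} (ha : 0 < a) (hs : 0 ≤ s) (had : a ≤ d) :
    F 0 (a + s) * F 0 d ≤ F 0 a * F 0 (d + s) := by
  have hq : ∀ {x y : ℝ}, 0 < x → x ≤ y → F 1 y / F 0 y ≤ F 1 x / F 0 x := by
    intro x y hx hxy
    have := le_of_hasDerivAt_nonneg (f := fun t => -(F 1 t / F 0 t)) hxy
      (fun t ht => (((h.hasDerivAt 1 t (hx.trans_le ht.1)).div (h.hasDerivAt 0 t (hx.trans_le ht.1))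
        (hpos 0 t (hx.trans_le ht.1)).ne').neg)) (fun t ht => by
        have ht0 := hx.trans_le ht.1
        rw [← neg_div]
        refine div_nonneg ?_ (sq_nonneg _)
        have := h.sq_le hpos ht0
        simp only [zero_add, one_add_one_eq_two]
        linarith)
    linarith
  have := le_of_hasDerivAt_nonneg (f := fun t => F 0 (t + s) / F 0 t) had
    (fun t ht => ((h.hasDerivAt 0 (t + s) (by linarith [ht.1])).comp_add_const t s).div
      (h.hasDerivAt 0 t (ha.trans_le ht.1)) (hpos 0 t (ha.trans_le ht.1)).ne') (fun t ht => by
        have ht0 := ha.trans_le ht.1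
        have h2 := hq ht0 (le_add_of_nonneg_right hs)
        rw [div_le_div_iff₀ (hpos 0 _ (by linarith)) (hpos 0 t ht0)] at h2
        refine div_nonneg ?_ (sq_nonneg _)
        simp only [zero_add]
        linarith)
  rw [div_le_div_iff₀ (hpos 0 a ha) (hpos 0 d (ha.trans_le had))] at this
  linarith

/-- A completely monotone function is log-convex. -/
theorem mul_le_mul (h : IsAlternatingDerivs F) {a d s : ℝ} (ha : 0 < a) (hs : 0 ≤ s)
    (had : a ≤ d) : F 0 (a + s) * F 0 d ≤ F 0 a * F 0 (d + s) := by
  -- Adding `ε exp (-x)`, itself completely monotone, makes all the functions strictly positive so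
  -- that quotients can be formed; then `ε → 0`.
  have hε : ∀ ε > 0, (F 0 (a + s) + ε * Real.exp (-(a + s))) * (F 0 d + ε * Real.exp (-d)) ≤
      (F 0 a + ε * Real.exp (-a)) * (F 0 (d + s) + ε * Real.exp (-(d + s))) := by
    intro ε hε
    have hpos : ∀ (n : ℕ) (x : ℝ), 0 < x → 0 < F n x + ε * Real.exp (-x) := fun n x hx =>
      add_pos_of_nonneg_of_pos (h.nonneg n x hx) (mul_pos hε (Real.exp_pos _))
    refine mul_le_mul_of_pos (F := fun n x => F n x + ε * Real.exp (-x))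
      ⟨fun n x hx => ?_, fun n x hx => (hpos n x hx).le⟩ hpos ha hs had
    refine ((h.hasDerivAt n x hx).add (((hasDerivAt_neg x).exp).const_mul ε)).congr_deriv ?_
    ring
  have hl : ∀ f : ℝ → ℝ, Continuous f → Tendsto f (𝓝[>] 0) (𝓝 (f 0)) := fun f hf =>
    (hf.tendsto 0).mono_left nhdsWithin_le_nhds
  have := le_of_tendsto_of_tendsto
    (hl (fun ε => (F 0 (a + s) + ε * Real.exp (-(a + s))) * (F 0 d + ε * Real.exp (-d)))
      (by fun_prop))
    (hl (fun ε => (F 0 a + ε * Real.exp (-a)) * (F 0 (d + s) + ε * Real.exp (-(d + s))))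
      (by fun_prop))
    (eventually_nhdsWithin_of_forall hε)
  simpa using this

/-- The mixed differences are double integrals of `F 2 (x + y)`. As `F 2` again starts an
alternating sequence, it is log-convex, which is the TP2 inequality for this kernel; integrating in
each variable gives the claim. -/
theorem rect_mul_le (h : IsAlternatingDerivs F) {x₁ x₂ x₃ x₄ y₁ y₂ y₃ y₄ : ℝ} (hx : 0 < x₁)
    (h12 : x₁ ≤ x₂) (h23 : x₂ ≤ x₃) (h34 : x₃ ≤ x₄) (hy : 0 < y₁) (k12 : y₁ ≤ y₂) (k23 : y₂ ≤ y₃)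
    (k34 : y₃ ≤ y₄) :
    (F 0 (x₁ + y₃) - F 0 (x₁ + y₄) - (F 0 (x₂ + y₃) - F 0 (x₂ + y₄))) *
      (F 0 (x₃ + y₁) - F 0 (x₃ + y₂) - (F 0 (x₄ + y₁) - F 0 (x₄ + y₂))) ≤
    (F 0 (x₁ + y₁) - F 0 (x₁ + y₂) - (F 0 (x₂ + y₁) - F 0 (x₂ + y₂))) *
      (F 0 (x₃ + y₃) - F 0 (x₃ + y₄) - (F 0 (x₄ + y₃) - F 0 (x₄ + y₄))) := by
  have hin : ∀ x ∈ Icc x₁ x₂, ∀ x' ∈ Icc x₃ x₄,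
      (F 1 (x + y₃) - F 1 (x + y₄)) * (F 1 (x' + y₁) - F 1 (x' + y₂)) ≤
      (F 1 (x + y₁) - F 1 (x + y₂)) * (F 1 (x' + y₃) - F 1 (x' + y₄)) := by
    intro x hxm x' hxm'
    have hd : ∀ z, x₁ ≤ z → ∀ t, y₁ ≤ t → HasDerivAt (fun t => -F 1 (z + t)) (F 2 (z + t)) t := by
      intro z hz t ht
      have := ((h.hasDerivAt 1 (z + t) (by linarith)).comp_const_add z t).neg
      rwa [neg_neg] at this
    have := sub_mul_sub_le_of_hasDerivAt (U := fun t => -F 1 (x + t)) (V := fun t => -F 1 (x' + t))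
      (U' := fun t => -F 1 (x' + t)) (V' := fun t => -F 1 (x + t)) k34 k12
      (fun t ht => hd x hxm.1 t (by linarith [ht.1]))
      (fun t ht => hd x' (by linarith [hxm'.1]) t (by linarith [ht.1]))
      (fun t ht => hd x' (by linarith [hxm'.1]) t (by linarith [ht.1]))
      (fun t ht => hd x hxm.1 t (by linarith [ht.1]))
      (fun y' hy' y hy'' => by
        have := (h.shift 2).mul_le_mul (a := x + y) (d := x' + y) (s := y' - y)
          (by linarith [hxm.1, hy''.1]) (by linarith [hy'.1, hy''.2]) (by linarith [hxm.2, hxm'.1])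
        simp only [zero_add] at this
        rw [show x + y + (y' - y) = x + y' by ring, show x' + y + (y' - y) = x' + y' by ring] at this
        linarith)
    linarith
  have hd : ∀ p, y₁ ≤ p → ∀ q, y₁ ≤ q → ∀ z, x₁ ≤ z →
      HasDerivAt (fun z => -(F 0 (z + p) - F 0 (z + q))) (F 1 (z + p) - F 1 (z + q)) z := by
    intro p hp q hq z hz
    refine (((h.hasDerivAt 0 (z + p) (by linarith)).comp_add_const z p).sub
      ((h.hasDerivAt 0 (z + q) (by linarith)).comp_add_const z q)).neg.congr_deriv ?_
    simp only [zero_add]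
    ring
  have := sub_mul_sub_le_of_hasDerivAt h12 h34
    (fun z hz => hd y₃ (by linarith) y₄ (by linarith) z hz.1)
    (fun z hz => hd y₁ (by linarith) y₂ (by linarith) z hz.1)
    (fun z hz => hd y₁ (by linarith) y₂ (by linarith) z (by linarith [hz.1]))
    (fun z hz => hd y₃ (by linarith) y₄ (by linarith) z (by linarith [hz.1])) hin
  linarith

end IsAlternatingDerivs

namespace IsCompletelyMonotone

variable {η : ℝ → ℝ}

theorem isAlternatingDerivs (h : IsCompletelyMonotone η) :
    IsAlternatingDerivs fun n x => (-1) ^ n * iteratedDeriv n η x where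
  hasDerivAt n x hx := by
    have h1 : DifferentiableAt ℝ (iteratedDeriv n η) x := by
      have h2 := h.contDiffOn.differentiableOn_iteratedDerivWithin (m := n)
        (by exact_mod_cast ENat.natCast_lt_top n) (uniqueDiffOn_Ioi 0)
      have h3 : DifferentiableOn ℝ (iteratedDeriv n η) (Ioi 0) :=
        h2.congr fun y hy => (iteratedDerivWithin_of_isOpen isOpen_Ioi hy).symm
      exact h3.differentiableAt (Ioi_mem_nhds hx)
    refine (h1.hasDerivAt.const_mul ((-1 : ℝ) ^ n)).congr_deriv ?_
    rw [iteratedDeriv_succ, pow_succ]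
    ring
  nonneg n x hx := h.alternating n x hx

theorem antitoneOn (h : IsCompletelyMonotone η) : AntitoneOn η (Ici 0) := by
  have hd := h.isAlternatingDerivs
  refine antitoneOn_of_hasDerivWithinAt_nonpos (convex_Ici 0) h.continuousOn
    (f' := fun x => -((-1) ^ 1 * iteratedDeriv 1 η x)) (fun x hx => ?_) (fun x hx => ?_)
  · rw [interior_Ici] at hx ⊢
    have := hd.hasDerivAt 0 x hx
    simp only [pow_zero, one_mul, iteratedDeriv_zero, zero_add] at this
    exact this.hasDerivWithinAt
  · rw [interior_Ici] at hx
    exact neg_nonpos.2 (hd.nonneg 1 x hx)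

/-- At the endpoint `0` only continuity is available, so all coordinates are shifted by `ε` and the
limit is taken. -/
theorem rect_mul_le (h : IsCompletelyMonotone η) {x₁ x₂ x₃ x₄ y₁ y₂ y₃ y₄ : ℝ} (hx : 0 ≤ x₁)
    (h12 : x₁ ≤ x₂) (h23 : x₂ ≤ x₃) (h34 : x₃ ≤ x₄) (hy : 0 ≤ y₁) (k12 : y₁ ≤ y₂) (k23 : y₂ ≤ y₃)
    (k34 : y₃ ≤ y₄) :
    (η (x₁ + y₃) - η (x₁ + y₄) - (η (x₂ + y₃) - η (x₂ + y₄))) *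
      (η (x₃ + y₁) - η (x₃ + y₂) - (η (x₄ + y₁) - η (x₄ + y₂))) ≤
    (η (x₁ + y₁) - η (x₁ + y₂) - (η (x₂ + y₁) - η (x₂ + y₂))) *
      (η (x₃ + y₃) - η (x₃ + y₄) - (η (x₄ + y₃) - η (x₄ + y₄))) := by
  have hl : ∀ x y, 0 ≤ x → 0 ≤ y →
      Tendsto (fun ε => η (x + ε + (y + ε))) (𝓝[>] 0) (𝓝 (η (x + y))) := by
    intro x y hx hy
    have h1 : Tendsto (fun ε : ℝ => x + ε + (y + ε)) (𝓝[>] 0) (𝓝[Ici 0] (x + y)) := by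
      refine tendsto_nhdsWithin_iff.2 ⟨?_, ?_⟩
      · have : Continuous fun ε : ℝ => x + ε + (y + ε) := by fun_prop
        have := this.tendsto 0
        simp only [add_zero] at this
        exact this.mono_left nhdsWithin_le_nhds
      · filter_upwards [self_mem_nhdsWithin] with ε hε
        have : (0 : ℝ) < ε := hε
        simp only [mem_Ici]
        linarith
    exact (h.continuousOn (x + y) (by simp only [mem_Ici]; linarith)).tendsto.comp h1
  have hr : ∀ x x' y y', 0 ≤ x → 0 ≤ x' → 0 ≤ y → 0 ≤ y' → Tendsto
      (fun ε => η (x + ε + (y + ε)) - η (x + ε + (y' + ε)) -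
        (η (x' + ε + (y + ε)) - η (x' + ε + (y' + ε)))) (𝓝[>] 0)
      (𝓝 (η (x + y) - η (x + y') - (η (x' + y) - η (x' + y')))) :=
    fun x x' y y' hx hx' hy hy' => ((hl x y hx hy).sub (hl x y' hx hy')).sub
      ((hl x' y hx' hy).sub (hl x' y' hx' hy'))
  refine le_of_tendsto_of_tendsto
    ((hr x₁ x₂ y₃ y₄ hx (by linarith) (by linarith) (by linarith)).mul
      (hr x₃ x₄ y₁ y₂ (by linarith) (by linarith) (by linarith) (by linarith)))
    ((hr x₁ x₂ y₁ y₂ hx (by linarith) (by linarith) (by linarith)).mul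
      (hr x₃ x₄ y₃ y₄ (by linarith) (by linarith) (by linarith) (by linarith))) ?_
  filter_upwards [self_mem_nhdsWithin] with ε hε
  have hε' : (0 : ℝ) < ε := hε
  have := h.isAlternatingDerivs.rect_mul_le (x₁ := x₁ + ε) (x₂ := x₂ + ε) (x₃ := x₃ + ε)
    (x₄ := x₄ + ε) (y₁ := y₁ + ε) (y₂ := y₂ + ε) (y₃ := y₃ + ε) (y₄ := y₄ + ε) (by linarith)
    (by linarith) (by linarith) (by linarith) (by linarith) (by linarith) (by linarith)
    (by linarith)
  simpa only [pow_zero, one_mul, iteratedDeriv_zero] using this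

end IsCompletelyMonotone

/-! ### Archimedean copulas -/

theorem Copula.tendsto_rectMass_max (C : Copula) {a b c d : ℝ} (ha : 0 ≤ a) (hb : 0 ≤ b)
    (hc : 0 ≤ c) (hd : 0 ≤ d) :
    Tendsto (fun ε => C.rectMass (max a ε) (max b ε) (max c ε) (max d ε)) (𝓝[>] 0)
      (𝓝 (C.rectMass a b c d)) := by
  have h : ∀ x y : ℝ, Continuous fun ε : ℝ => C.cdf (max x ε) (max y ε) := fun x y =>
    C.continuous_cdf.comp (by fun_prop : Continuous fun ε : ℝ => (max x ε, max y ε))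
  have h2 : Continuous fun ε => C.rectMass (max a ε) (max b ε) (max c ε) (max d ε) :=
    ((h b d).sub (h a d)).sub ((h b c).sub (h a c))
  have := h2.tendsto 0
  rw [max_eq_left ha, max_eq_left hb, max_eq_left hc, max_eq_left hd] at this
  exact this.mono_left nhdsWithin_le_nhds

/-- Archimedean formulas hold only for positive arguments. Replacing each endpoint by its maximum
with `ε` and using continuity of the distribution function reaches the edges. -/
theorem Copula.rectTP2_of_pos {C : Copula}
    (h : ∀ a b a' b' c d c' d' : ℝ, 0 < a → a ≤ b → b ≤ a' → a' ≤ b' → b' ≤ 1 →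
    0 < c → c ≤ d → d ≤ c' → c' ≤ d' → d' ≤ 1 →
    C.rectMass a b c' d' * C.rectMass a' b' c d ≤ C.rectMass a b c d * C.rectMass a' b' c' d') :
    C.RectTP2 := by
  intro a b a' b' c d c' d' ha hab hba hab' hb' hc hcd hdc hcd' hd'
  have t := fun {a b c d} => C.tendsto_rectMass_max (a := a) (b := b) (c := c) (d := d)
  refine le_of_tendsto_of_tendsto
    ((t ha (by linarith) (by linarith) (by linarith)).mul
      (t (by linarith) (by linarith) hc (by linarith)))
    ((t ha (by linarith) hc (by linarith)).mul
      (t (by linarith) (by linarith) (by linarith) (by linarith))) ?_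
  filter_upwards [Ioc_mem_nhdsGT (zero_lt_one' ℝ)] with ε hε
  exact h _ _ _ _ _ _ _ _ (lt_max_of_lt_right hε.1) (max_le_max_right _ hab)
    (max_le_max_right _ hba) (max_le_max_right _ hab') (max_le hb' hε.2) (lt_max_of_lt_right hε.1)
    (max_le_max_right _ hcd) (max_le_max_right _ hdc) (max_le_max_right _ hcd') (max_le hd' hε.2)

/-- A copula with a completely monotone Archimedean generator is totally positive. -/
theorem IsCompletelyMonotone.rectTP2 {C : Copula} {η α : ℝ → ℝ} (h : IsCompletelyMonotone η)
    (hα : ∀ u ∈ Ioc (0 : ℝ) 1, 0 ≤ α u) (hηα : ∀ u ∈ Ioc (0 : ℝ) 1, η (α u) = u)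
    (hC : ∀ u ∈ Ioc (0 : ℝ) 1, ∀ v ∈ Ioc (0 : ℝ) 1, C.cdf u v = η (α u + α v)) : C.RectTP2 := by
  have hanti : ∀ u ∈ Ioc (0 : ℝ) 1, ∀ v ∈ Ioc (0 : ℝ) 1, u ≤ v → α v ≤ α u := by
    intro u hu v hv huv
    by_contra hlt
    have hlt' := (not_le.1 hlt).le
    have := h.antitoneOn (hα u hu) (hα v hv) hlt'
    rw [hηα u hu, hηα v hv] at this
    have := le_antisymm huv this
    subst this
    exact hlt le_rfl
  refine Copula.rectTP2_of_pos fun a b a' b' c d c' d' ha hab hba hab' hb' hc hcd hdc hcd' hd' => ?_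
  have ma : a ∈ Ioc (0 : ℝ) 1 := ⟨ha, by linarith⟩
  have mb : b ∈ Ioc (0 : ℝ) 1 := ⟨by linarith, by linarith⟩
  have ma' : a' ∈ Ioc (0 : ℝ) 1 := ⟨by linarith, by linarith⟩
  have mb' : b' ∈ Ioc (0 : ℝ) 1 := ⟨by linarith, by linarith⟩
  have mc : c ∈ Ioc (0 : ℝ) 1 := ⟨hc, by linarith⟩
  have md : d ∈ Ioc (0 : ℝ) 1 := ⟨by linarith, by linarith⟩
  have mc' : c' ∈ Ioc (0 : ℝ) 1 := ⟨by linarith, by linarith⟩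
  have md' : d' ∈ Ioc (0 : ℝ) 1 := ⟨by linarith, by linarith⟩
  -- The map `α` is decreasing, so both coordinates are reversed, and TP2 is invariant under
  -- reversing both.
  have := h.rect_mul_le (hα _ mb') (hanti _ ma' _ mb' hab') (hanti _ mb _ ma' hba)
    (hanti _ ma _ mb hab) (hα _ md') (hanti _ mc' _ md' hcd') (hanti _ md _ mc' hdc)
    (hanti _ mc _ md hcd)
  simp only [Copula.rectMass]
  rw [hC b mb d' md', hC a ma d' md', hC b mb c' mc', hC a ma c' mc', hC b' mb' d md,
    hC a' ma' d md, hC b' mb' c mc, hC a' ma' c mc, hC b mb d md, hC a ma d md, hC b mb c mc,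
    hC a ma c mc, hC b' mb' d' md', hC a' ma' d' md', hC b' mb' c' mc', hC a' ma' c' mc']
  linarith

theorem genInv_nonneg {ψ : ℝ → ℝ} (h : SurjOn ψ (Ici 0) (Ioc 0 1)) {u : ℝ}
    (hu : u ∈ Ioc (0 : ℝ) 1) : 0 ≤ genInv ψ u :=
  Function.invFunOn_mem (h hu)

theorem apply_genInv {ψ : ℝ → ℝ} (h : SurjOn ψ (Ici 0) (Ioc 0 1)) {u : ℝ}
    (hu : u ∈ Ioc (0 : ℝ) 1) : ψ (genInv ψ u) = u :=
  Function.invFunOn_eq (h hu)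

theorem IsArchimedean.rectTP2 {C : Copula} {φ : ℝ → ℝ} (h : IsArchimedean C φ)
    (hφ : IsCompletelyMonotone φ) : C.RectTP2 :=
  hφ.rectTP2 (fun _ hu => genInv_nonneg h.surjOn hu) (fun _ hu => apply_genInv h.surjOn hu)
    h.cdf_eq

/-- By dominated convergence the transform is continuous with value one at `0`, and tends to zero
since the variable is positive; the intermediate value theorem does the rest. -/
theorem IsLaplaceTransform.surjOn {ψ : ℝ → ℝ} (h : IsLaplaceTransform ψ) :
    SurjOn ψ (Ici 0) (Ioc 0 1) := by
  obtain ⟨M, hM, hM0, hψ⟩ := h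
  have hae : ∀ᵐ α ∂M, 0 < α := by
    rw [ae_iff]
    have : {α : ℝ | ¬0 < α} = Iic 0 := by ext α; simp
    rw [this, hM0]
  have hmeas : ∀ s : ℝ, AEStronglyMeasurable (fun α => Real.exp (-(s * α))) M := fun s =>
    (by fun_prop : Measurable fun α : ℝ => Real.exp (-(s * α))).aestronglyMeasurable
  have hbd : ∀ s : ℝ, 0 ≤ s → ∀ᵐ α ∂M, ‖Real.exp (-(s * α))‖ ≤ 1 := by
    intro s hs
    filter_upwards [hae] with α hα
    rw [Real.norm_of_nonneg (Real.exp_pos _).le, Real.exp_le_one_iff]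
    have := mul_nonneg hs hα.le
    linarith
  have hcont : ContinuousOn ψ (Ici 0) := by
    refine ContinuousOn.congr (f := fun s => ∫ α, Real.exp (-(s * α)) ∂M) ?_ fun s hs => hψ s hs
    refine continuousOn_of_dominated (bound := fun _ => 1) (fun s _ => hmeas s) hbd
      (integrable_const 1) (Eventually.of_forall fun α => by fun_prop)
  have h0 : ψ 0 = 1 := by rw [hψ 0 le_rfl]; simp
  have hlim : Tendsto ψ atTop (𝓝 0) := by
    have h1 : Tendsto (fun s : ℝ => ∫ α, Real.exp (-(s * α)) ∂M) atTop (𝓝 (∫ _, (0 : ℝ) ∂M)) := by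
      refine tendsto_integral_filter_of_dominated_convergence (fun _ => 1)
        (Eventually.of_forall hmeas) ?_ (integrable_const 1) ?_
      · filter_upwards [eventually_ge_atTop 0] with s hs using hbd s hs
      · filter_upwards [hae] with α hα
        exact Real.tendsto_exp_neg_atTop_nhds_zero.comp (tendsto_id.atTop_mul_const hα)
    rw [integral_zero] at h1
    refine h1.congr' ?_
    filter_upwards [eventually_ge_atTop 0] with s hs using (hψ s hs).symm
  rintro u ⟨hu0, hu1⟩
  obtain ⟨T, hT0, hT⟩ :=
    ((eventually_ge_atTop (0 : ℝ)).and (hlim.eventually (gt_mem_nhds hu0))).exists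
  obtain ⟨s, hs, hs'⟩ := intermediate_value_Icc' hT0 (hcont.mono Icc_subset_Ici_self)
    ⟨hT.le, by rw [h0]; exact hu1⟩
  exact ⟨s, hs.1, hs'⟩

/-- Expanding the inner copula gives an Archimedean form: `u ↦ φ⁻¹(exp(-ψ⁻¹(u)))` is a right inverse
of `η = ψ ∘ (-log φ)` on `(0, 1]`. -/
theorem IsTwoParamArchimedean.rectTP2 {C K : Copula} {ψ φ : ℝ → ℝ}
    (h : IsTwoParamArchimedean C K ψ φ) (hη : IsCompletelyMonotone (twoParamGenerator ψ φ)) :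
    C.RectTP2 := by
  have hψ := h.laplace.surjOn
  have hmem : ∀ u ∈ Ioc (0 : ℝ) 1, Real.exp (-genInv ψ u) ∈ Ioc (0 : ℝ) 1 := fun u hu =>
    ⟨Real.exp_pos _, Real.exp_le_one_iff.2 (neg_nonpos.2 (genInv_nonneg hψ hu))⟩
  refine hη.rectTP2 (α := fun u => genInv φ (Real.exp (-genInv ψ u)))
    (fun u hu => genInv_nonneg h.inner.surjOn (hmem u hu)) (fun u hu => ?_) fun u hu v hv => ?_
  · rw [twoParamGenerator, apply_genInv h.inner.surjOn (hmem u hu), Real.log_exp, neg_neg,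
      apply_genInv hψ hu]
  · rw [h.cdf_eq u hu v hv, h.inner.cdf_eq _ (hmem u hu) _ (hmem v hv), twoParamGenerator]

/-! ### Entropy and mutual information -/

namespace Copula

theorem AbsCont.setLIntegral_density {C : Copula} (h : C.AbsCont) {s : Set (ℝ × ℝ)}
    (hs : MeasurableSet s) : ∫⁻ p in s, ENNReal.ofReal (C.density p) = C.law s := by
  rw [← withDensity_apply _ hs, h.withDensity_density]

theorem law_square (C : Copula) : C.law (Icc (0 : ℝ) 1 ×ˢ Icc (0 : ℝ) 1) = 1 := by
  rw [← prob_compl_eq_zero_iff (measurableSet_Icc.prod measurableSet_Icc)]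
  have h1 : C.law ((Icc (0 : ℝ) 1)ᶜ ×ˢ univ) = 0 := by
    rw [prod_univ, ← Measure.fst_apply measurableSet_Icc.compl, C.fst_law,
      Measure.restrict_apply measurableSet_Icc.compl, compl_inter_self, measure_empty]
  have h2 : C.law (univ ×ˢ (Icc (0 : ℝ) 1)ᶜ) = 0 := by
    rw [univ_prod, ← Measure.snd_apply measurableSet_Icc.compl, C.snd_law,
      Measure.restrict_apply measurableSet_Icc.compl, compl_inter_self, measure_empty]
  rw [compl_prod_eq_union]
  exact measure_union_null h1 h2

/-- The integrand of the divergence is `c log c + 1 - c`, and `1 - c` has integral zero. The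
identity is proved additively in `ENNReal`; the subtraction comes last, once the negative part is
known to be finite. -/
theorem AbsCont.negEntropy_eq {C : Copula} (h : C.AbsCont) :
    C.negEntropy = (C.divergence : EReal) := by
  set sq : Set (ℝ × ℝ) := Icc (0 : ℝ) 1 ×ˢ Icc (0 : ℝ) 1 with hsq
  have hsqm : MeasurableSet sq := measurableSet_Icc.prod measurableSet_Icc
  have hvol : volume sq = 1 := by
    rw [hsq, Measure.volume_eq_prod, Measure.prod_prod, Real.volume_Icc]; simp
  have hcm := C.measurable_density
  have hm1 : Measurable fun p => C.density p * Real.log (C.density p) :=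
    hcm.mul (Real.measurable_log.comp hcm)
  have hmk : Measurable fun p => ENNReal.ofReal (InformationTheory.klFun (C.density p)) :=
    (InformationTheory.measurable_klFun.comp hcm).ennreal_ofReal
  have hc1 : ∫⁻ p in sq, ENNReal.ofReal (C.density p) = 1 := by
    rw [h.setLIntegral_density hsqm, law_square]
  -- From `klFun ≥ 0` follows `-(x log x) ≤ 1 - x ≤ 1`.
  have hb : ∫⁻ p in sq, ENNReal.ofReal (-(C.density p * Real.log (C.density p))) ≠ ⊤ := by
    refine ne_top_of_le_ne_top ENNReal.one_ne_top ?_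
    calc _ ≤ ∫⁻ _ in sq, (1 : ENNReal) := by
          refine lintegral_mono fun p => ?_
          rw [← ENNReal.ofReal_one]
          refine ENNReal.ofReal_le_ofReal ?_
          have := InformationTheory.klFun_nonneg (C.density_nonneg p)
          have := C.density_nonneg p
          rw [InformationTheory.klFun_apply] at *
          linarith
      _ = 1 := by rw [setLIntegral_one, hvol]
  have hsum : C.divergence + ∫⁻ p in sq, ENNReal.ofReal (-(C.density p * Real.log (C.density p))) =
      ∫⁻ p in sq, ENNReal.ofReal (C.density p * Real.log (C.density p)) := by
    refine (ENNReal.add_left_inj ENNReal.one_ne_top).1 ?_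
    have e1 : ∫⁻ _ in sq, (1 : ENNReal) = 1 := by rw [setLIntegral_one, hvol]
    calc _ = (∫⁻ p in sq, ENNReal.ofReal (InformationTheory.klFun (C.density p))) +
          (∫⁻ p in sq, ENNReal.ofReal (-(C.density p * Real.log (C.density p)))) +
          ∫⁻ p in sq, ENNReal.ofReal (C.density p) := by rw [hc1, divergence]
      _ = (∫⁻ p in sq, ENNReal.ofReal (C.density p * Real.log (C.density p))) +
          ∫⁻ _ in sq, (1 : ENNReal) := by
        rw [← lintegral_add_left hmk, ← lintegral_add_right _ hcm.ennreal_ofReal,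
          ← lintegral_add_right _ measurable_const]
        refine lintegral_congr fun p => ?_
        have h0 := C.density_nonneg p
        have h1 := InformationTheory.klFun_nonneg h0
        rw [InformationTheory.klFun_apply] at *
        rcases le_total 0 (C.density p * Real.log (C.density p)) with hp | hp
        · rw [ENNReal.ofReal_of_nonpos (neg_nonpos.2 hp), add_zero, ← ENNReal.ofReal_add h1 h0,
            ← ENNReal.ofReal_one, ← ENNReal.ofReal_add hp zero_le_one]
          congr 1; ring
        · rw [ENNReal.ofReal_of_nonpos hp, ← ENNReal.ofReal_add h1 (neg_nonneg.2 hp),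
            ← ENNReal.ofReal_add (add_nonneg h1 (neg_nonneg.2 hp)) h0, zero_add,
            ← ENNReal.ofReal_one]
          congr 1; ring
      _ = _ := by rw [e1]
  rw [negEntropy, ← hsum, EReal.coe_ennreal_add, ← hsq, ← EReal.coe_toReal (x := ((∫⁻ p in sq,
    ENNReal.ofReal (-(C.density p * Real.log (C.density p))) : ENNReal) : EReal)) (by simpa using hb)
    (EReal.coe_ennreal_ne_bot _), EReal.add_sub_cancel_right]

/-- The Radon-Nikodym density is a version of the copula density. -/
theorem AbsCont.isDensity {C : Copula} (h : C.AbsCont) : C.IsDensity C.density where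
  measurable := C.measurable_density
  nonneg := C.density_nonneg
  law_eq := by
    have hsq : MeasurableSet (Icc (0 : ℝ) 1 ×ˢ Icc (0 : ℝ) 1) := measurableSet_Icc.prod measurableSet_Icc
    rw [← restrict_withDensity hsq, h.withDensity_density]
    refine (Measure.restrict_eq_self_of_ae_mem ?_).symm
    exact (prob_compl_eq_zero_iff hsq).2 C.law_square

end Copula

/-! ### The probability integral transform -/

theorem continuous_real_Iic (μ : Measure ℝ) [IsFiniteMeasure μ] [NullSingletonClass μ] :
    Continuous fun x => μ.real (Iic x) := by
  have h : ∀ x, μ.real (Iic x) = μ.real (Iic 0) + ∫ _ in (0 : ℝ)..x, (1 : ℝ) ∂μ := by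
    intro x
    have h1 : IntegrableOn (fun _ => (1 : ℝ)) univ μ := (integrable_const 1).integrableOn
    rw [← intervalIntegral.integral_Iic_sub_Iic (h1.mono_set (subset_univ _))
      (h1.mono_set (subset_univ _))]
    simp
  rw [funext h]
  exact continuous_const.add
    (intervalIntegral.continuous_primitive (fun _ _ => intervalIntegrable_const) 0)

theorem monotone_real_Iic (μ : Measure ℝ) [IsFiniteMeasure μ] : Monotone fun x => μ.real (Iic x) :=
  fun _ _ h => measureReal_mono (Iic_subset_Iic.2 h)

section ProbabilityIntegralTransform

variable (μ : Measure ℝ) [IsProbabilityMeasure μ] [NullSingletonClass μ]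

/-- The distribution function may be flat to the right of `x`. If its value there is below one, the
sublevel set is closed and bounded above, so it contains its supremum and lies in the half-line up
to it. -/
theorem real_setOf_real_Iic_le (x : ℝ) :
    μ.real {y | μ.real (Iic y) ≤ μ.real (Iic x)} = μ.real (Iic x) := by
  have hmono := monotone_real_Iic μ
  refine le_antisymm ?_ (measureReal_mono fun y hy => hmono hy)
  set S := {y | μ.real (Iic y) ≤ μ.real (Iic x)} with hS
  rcases (measureReal_le_one (μ := μ) (s := Iic x)).lt_or_eq with hlt | heq
  swap
  · rw [heq]; exact measureReal_le_one
  have hclosed : IsClosed S := isClosed_le (continuous_real_Iic μ) continuous_const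
  have hbdd : BddAbove S := by
    have h1 := ProbabilityTheory.tendsto_cdf_atTop μ
    obtain ⟨T, hT⟩ := (h1.eventually (lt_mem_nhds hlt)).exists
    rw [ProbabilityTheory.cdf_eq_real] at hT
    refine ⟨T, fun y hy => ?_⟩
    by_contra hc
    exact absurd (hT.trans_le (hmono (not_le.1 hc).le)) (not_lt.2 hy)
  have hmem := hclosed.csSup_mem ⟨x, le_refl (μ.real (Iic x))⟩ hbdd
  exact (measureReal_mono fun y hy => le_csSup hbdd hy).trans hmem

theorem setOf_real_Iic_le_ae_eq (x : ℝ) :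
    ({y | μ.real (Iic y) ≤ μ.real (Iic x)} : Set ℝ) =ᵐ[μ] Iic x := by
  have hsub : Iic x ⊆ {y | μ.real (Iic y) ≤ μ.real (Iic x)} := fun y hy => monotone_real_Iic μ hy
  have hle : μ {y | μ.real (Iic y) ≤ μ.real (Iic x)} ≤ μ (Iic x) := by
    rw [← ENNReal.toReal_le_toReal (measure_ne_top _ _) (measure_ne_top _ _)]
    exact (real_setOf_real_Iic_le μ x).le
  exact (ae_eq_of_subset_of_measure_ge hsub hle measurableSet_Iic.nullMeasurableSet
    (measure_ne_top _ _)).symm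

/-- The probability integral transform. -/
theorem map_real_Iic : μ.map (fun x => μ.real (Iic x)) = volume.restrict (Icc 0 1) := by
  have hmeas : Measurable fun x => μ.real (Iic x) := (continuous_real_Iic μ).measurable
  have : IsProbabilityMeasure (μ.map fun x => μ.real (Iic x)) :=
    Measure.isProbabilityMeasure_map hmeas.aemeasurable
  refine Measure.ext_of_Iic _ _ fun u => ?_
  rw [Measure.map_apply hmeas measurableSet_Iic, Measure.restrict_apply measurableSet_Iic]
  rcases lt_or_ge u 0 with hu | hu
  · have h1 : (fun x => μ.real (Iic x)) ⁻¹' Iic u = ∅ := by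
      ext y
      simp only [mem_preimage, mem_Iic, mem_empty_iff_false, iff_false, not_le]
      exact hu.trans_le measureReal_nonneg
    have h2 : Iic u ∩ Icc 0 1 = ∅ := by
      ext y
      simp only [mem_inter_iff, mem_Iic, mem_Icc, mem_empty_iff_false, iff_false]
      intro h; linarith [h.1, h.2.1]
    rw [h1, h2, measure_empty, measure_empty]
  rcases le_or_gt 1 u with hu1 | hu1
  · have h1 : (fun x => μ.real (Iic x)) ⁻¹' Iic u = univ := by
      ext y
      simp only [mem_preimage, mem_Iic, mem_univ, iff_true]
      exact measureReal_le_one.trans hu1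
    have h2 : Iic u ∩ Icc 0 1 = Icc 0 1 := inter_eq_right.2 fun y hy => hy.2.trans hu1
    rw [h1, h2, measure_univ, Real.volume_Icc]
    simp
  have h2 : Iic u ∩ Icc 0 1 = Icc 0 u := by
    ext y
    simp only [mem_inter_iff, mem_Iic, mem_Icc]
    exact ⟨fun h => ⟨h.2.1, h.1⟩, fun h => ⟨h.2, h.1, h.2.trans hu1.le⟩⟩
  rw [h2, Real.volume_Icc, sub_zero]
  by_cases hx : ∃ x, μ.real (Iic x) = u
  · obtain ⟨x, rfl⟩ := hx
    change μ {y | μ.real (Iic y) ≤ μ.real (Iic x)} = _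
    rw [measure_congr (setOf_real_Iic_le_ae_eq μ x), ofReal_measureReal]
  -- A continuous distribution function attains every value strictly between `0` and `1`, so only
  -- `0` can be missed.
  have hu0 : u = 0 := by
    by_contra hne
    have hpos : 0 < u := lt_of_le_of_ne hu (Ne.symm hne)
    obtain ⟨a, ha⟩ := ((ProbabilityTheory.tendsto_cdf_atBot μ).eventually (gt_mem_nhds hpos)).exists
    obtain ⟨b, hb⟩ := ((ProbabilityTheory.tendsto_cdf_atTop μ).eventually (lt_mem_nhds hu1)).exists
    rw [ProbabilityTheory.cdf_eq_real] at ha hb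
    exact hx (mem_range_of_exists_le_of_exists_ge (continuous_real_Iic μ) ⟨a, ha.le⟩ ⟨b, hb.le⟩)
  have h1 : (fun x => μ.real (Iic x)) ⁻¹' Iic u = ∅ := by
    ext y
    simp only [mem_preimage, mem_Iic, mem_empty_iff_false, iff_false]
    intro hy
    exact hx ⟨y, le_antisymm hy (by rw [hu0]; exact measureReal_nonneg)⟩
  rw [h1, measure_empty, hu0, ENNReal.ofReal_zero]

end ProbabilityIntegralTransform

namespace HasCopula

variable {P : Measure (ℝ × ℝ)} {C : Copula}

/-- The joint probability integral transform of the coordinates. -/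
def transform (P : Measure (ℝ × ℝ)) : ℝ × ℝ → ℝ × ℝ :=
  Prod.map (fun x => P.fst.real (Iic x)) fun y => P.snd.real (Iic y)

theorem measurable_transform (h : HasCopula P C) : Measurable (transform P) := by
  have := h.isProbabilityMeasure
  have := h.fst_nullSingleton
  have := h.snd_nullSingleton
  exact (continuous_real_Iic P.fst).measurable.prodMap (continuous_real_Iic P.snd).measurable

theorem map_transform (h : HasCopula P C) : (P.fst.prod P.snd).map (transform P) =
    volume.restrict (Icc (0 : ℝ) 1 ×ˢ Icc (0 : ℝ) 1) := by
  have := h.isProbabilityMeasure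
  have := h.fst_nullSingleton
  have := h.snd_nullSingleton
  rw [transform, ← Measure.map_prod_map _ _ (continuous_real_Iic P.fst).measurable
    (continuous_real_Iic P.snd).measurable, map_real_Iic, map_real_Iic, Measure.prod_restrict,
    ← Measure.volume_eq_prod]

/-- A law with an absolutely continuous copula has a density with respect to the product of its
marginals. -/
theorem eq_withDensity (h : HasCopula P C) (hC : C.AbsCont) :
    P = (P.fst.prod P.snd).withDensity fun p => ENNReal.ofReal (C.density (transform P p)) := by
  have := h.isProbabilityMeasure
  have := h.fst_nullSingleton
  have := h.snd_nullSingleton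
  have hΦ := h.measurable_transform
  set P' := (P.fst.prod P.snd).withDensity fun p => ENNReal.ofReal (C.density (transform P p))
    with hP'
  have hpre : ∀ A, MeasurableSet A → P' (transform P ⁻¹' A) = C.law A := by
    intro A hA
    rw [hP', withDensity_apply _ (hΦ hA), ← setLIntegral_map hA C.measurable_density.ennreal_ofReal
      hΦ, h.map_transform, ← withDensity_apply _ hA, ← hC.isDensity.law_eq]
  have hgen : (Prod.instMeasurableSpace : MeasurableSpace (ℝ × ℝ)) = MeasurableSpace.generateFrom
      (image2 (· ×ˢ ·) (range (Iic : ℝ → Set ℝ)) (range (Iic : ℝ → Set ℝ))) := by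
    have hsp : IsCountablySpanning (range (Iic : ℝ → Set ℝ)) :=
      ⟨fun n : ℕ => Iic (n : ℝ), fun n => ⟨_, rfl⟩, by
        refine eq_univ_of_forall fun x => ?_
        obtain ⟨n, hn⟩ := exists_nat_ge x
        exact mem_iUnion.2 ⟨n, hn⟩⟩
    rw [← generateFrom_prod_eq hsp hsp, ← borel_eq_generateFrom_Iic, ← BorelSpace.measurable_eq]
  refine ext_of_generate_finite _ hgen (isPiSystem_Iic.prod isPiSystem_Iic) ?_ ?_
  · rintro _ ⟨_, ⟨x, rfl⟩, _, ⟨y, rfl⟩, rfl⟩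
    -- Flat pieces of the marginal distribution functions are null, so a quadrant agrees almost
    -- everywhere with a preimage under the transform, where the measure is known by `hpre`.
    have hae : (Iic x ×ˢ Iic y : Set (ℝ × ℝ)) =ᵐ[P'] transform P ⁻¹'
        (Iic (P.fst.real (Iic x)) ×ˢ Iic (P.snd.real (Iic y))) := by
      refine (withDensity_absolutelyContinuous _ _).ae_eq ?_
      exact Measure.set_prod_ae_eq (setOf_real_Iic_le_ae_eq P.fst x).symm
        (setOf_real_Iic_le_ae_eq P.snd y).symm
    have hc := h.cdf_eq x y
    rw [Copula.cdf, measureReal_def, measureReal_def,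
      ENNReal.toReal_eq_toReal_iff' (measure_ne_top _ _) (measure_ne_top _ _)] at hc
    simp only
    rw [measure_congr hae, hpre _ (measurableSet_Iic.prod measurableSet_Iic), hc]
  · rw [measure_univ, ← preimage_univ (f := transform P), hpre _ MeasurableSet.univ, measure_univ]

theorem absolutelyContinuous (h : HasCopula P C) (hC : C.AbsCont) : P ≪ P.fst.prod P.snd := by
  nth_rewrite 1 [h.eq_withDensity hC]
  exact withDensity_absolutelyContinuous _ _

/-- The mutual information depends on the copula only. -/
theorem mutualInfo_eq (h : HasCopula P C) (hC : C.AbsCont) : mutualInfo P = C.divergence := by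
  have := h.isProbabilityMeasure
  have hΦ := h.measurable_transform
  have hm : Measurable fun p => ENNReal.ofReal (C.density (transform P p)) :=
    (C.measurable_density.comp hΦ).ennreal_ofReal
  have hk : Measurable fun p => ENNReal.ofReal (InformationTheory.klFun (C.density p)) :=
    (InformationTheory.measurable_klFun.comp C.measurable_density).ennreal_ofReal
  have hrn := Measure.rnDeriv_withDensity (P.fst.prod P.snd) hm
  rw [← h.eq_withDensity hC] at hrn
  rw [mutualInfo, InformationTheory.klDiv_eq_lintegral_klFun_of_ac (h.absolutelyContinuous hC),
    Copula.divergence, ← h.map_transform, lintegral_map hk hΦ]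
  refine lintegral_congr_ae ?_
  filter_upwards [hrn] with p hp
  rw [hp, ENNReal.toReal_ofReal (C.density_nonneg _)]

end HasCopula

theorem entropyMonotone_of_divergence_le {Θ : Set ℝ} {C : ℝ → Copula}
    (hC : ∀ θ ∈ Θ, (C θ).AbsCont)
    (h : ∀ θ₁ ∈ Θ, ∀ θ₂ ∈ Θ, AwayFromZero θ₁ θ₂ → (C θ₁).divergence ≤ (C θ₂).divergence) :
    EntropyMonotone Θ C := by
  intro θ₁ h₁ θ₂ h₂ h12
  refine ⟨?_, fun P P' hP hP' => ?_⟩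
  · rw [(hC θ₁ h₁).negEntropy_eq, (hC θ₂ h₂).negEntropy_eq]
    exact EReal.coe_ennreal_le_coe_ennreal_iff.2 (h θ₁ h₁ θ₂ h₂ h12)
  · rw [hP.mutualInfo_eq (hC θ₁ h₁), hP'.mutualInfo_eq (hC θ₂ h₂)]
    exact h θ₁ h₁ θ₂ h₂ h12

/-! ### Differences of identically distributed variables -/

/-- Clamping is monotone and 1-Lipschitz. The first bound supplies the domination, the second a
lower bound uniform in `n`. -/
theorem sub_clamp_bounds (x y n : ℝ) :
    |max (-n) (min n x) - max (-n) (min n y)| ≤ |x - y| ∧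
      min 0 (x - y) ≤ max (-n) (min n x) - max (-n) (min n y) := by
  have h1 : ∀ {a b : ℝ}, a ≤ b → 0 ≤ max (-n) (min n b) - max (-n) (min n a) ∧
      max (-n) (min n b) - max (-n) (min n a) ≤ b - a := by
    intro a b hab
    constructor
    · have := max_le_max_left (-n) (min_le_min_left n hab)
      linarith
    · rcases le_total (-n) (min n b) with h | h
      · rw [max_eq_right h]
        rcases le_total n a with h' | h'
        · have := le_max_right (-n) (min n a)
          rw [min_eq_left h'] at this ⊢
          have := min_le_left n b
          linarith
        · rw [min_eq_right h']
          have := le_max_right (-n) a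
          have := min_le_right n b
          linarith
      · rw [max_eq_left h]
        have := le_max_left (-n) (min n a)
        linarith
  rcases le_total x y with h | h
  · obtain ⟨h2, h3⟩ := h1 h
    refine ⟨?_, (min_le_right _ _).trans (by linarith)⟩
    rw [abs_of_nonpos (by linarith), abs_of_nonpos (by linarith)]
    linarith
  · obtain ⟨h2, h3⟩ := h1 h
    refine ⟨?_, (min_le_left _ _).trans h2⟩
    rw [abs_of_nonneg h2, abs_of_nonneg (by linarith)]
    exact h3

/-- If two random variables have the same law and their difference has an integrable lower bound,
then the difference is integrable with vanishing mean. -/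
theorem integrable_sub_of_map_eq {Ω : Type*} [MeasurableSpace Ω] {μ : Measure Ω}
    [IsFiniteMeasure μ] {X Y h : Ω → ℝ} (hX : Measurable X) (hY : Measurable Y)
    (hXY : μ.map X = μ.map Y) (hh : Integrable h μ) (hle : ∀ᵐ ω ∂μ, -h ω ≤ X ω - Y ω) :
    Integrable (fun ω => X ω - Y ω) μ ∧ ∫ ω, (X ω - Y ω) ∂μ = 0 := by
  -- The variables need not be integrable separately. Their truncations are, and have equal means
  -- because the laws agree.
  let T : ℕ → ℝ → ℝ := fun n x => max (-n) (min n x)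
  have hT : ∀ n, Measurable (T n) := fun n => by fun_prop
  have hTb : ∀ n x, ‖T n x‖ ≤ n := by
    intro n x
    rw [Real.norm_eq_abs, abs_le]
    have hn : (0 : ℝ) ≤ n := Nat.cast_nonneg n
    exact ⟨le_max_left _ _, max_le (by linarith) (min_le_left _ _)⟩
  have hTi : ∀ n (U : Ω → ℝ), Measurable U → Integrable (fun ω => T n (U ω)) μ := fun n U hU =>
    (integrable_const (n : ℝ)).mono' ((hT n).comp hU).aestronglyMeasurable
      (Eventually.of_forall fun ω => hTb n _)
  let D : ℕ → Ω → ℝ := fun n ω => T n (X ω) - T n (Y ω)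
  have hDi : ∀ n, Integrable (D n) μ := fun n => (hTi n X hX).sub (hTi n Y hY)
  have hD0 : ∀ n, ∫ ω, D n ω ∂μ = 0 := by
    intro n
    have e : ∀ U : Ω → ℝ, Measurable U → ∫ ω, T n (U ω) ∂μ = ∫ x, T n x ∂(μ.map U) := fun U hU =>
      (integral_map hU.aemeasurable (hT n).aestronglyMeasurable).symm
    rw [integral_sub (hTi n X hX) (hTi n Y hY), e X hX, e Y hY, hXY, sub_self]
  have hDlim : ∀ ω, Tendsto (fun n => D n ω) atTop (𝓝 (X ω - Y ω)) := by
    have hTlim : ∀ x, Tendsto (fun n : ℕ => T n x) atTop (𝓝 x) := by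
      intro x
      refine tendsto_const_nhds.congr' ?_
      obtain ⟨N, hN⟩ := exists_nat_ge |x|
      filter_upwards [eventually_ge_atTop N] with n hn
      have : |x| ≤ n := hN.trans (by exact_mod_cast hn)
      rw [abs_le] at this
      simp only [T]
      rw [min_eq_right this.2, max_eq_right this.1]
    exact fun ω => (hTlim _).sub (hTlim _)
  have hDlow : ∀ n, ∀ᵐ ω ∂μ, 0 ≤ D n ω + |h ω| := by
    intro n
    filter_upwards [hle] with ω hω
    have h1 := (sub_clamp_bounds (X ω) (Y ω) n).2
    have h2 := le_abs_self (h ω)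
    have h3 : -|h ω| ≤ min 0 (X ω - Y ω) :=
      le_min (neg_nonpos.2 (abs_nonneg _)) (by linarith)
    have h4 : min 0 (X ω - Y ω) ≤ D n ω := h1
    linarith
  have hint : Integrable (fun ω => X ω - Y ω) μ := by
    have hsum : Integrable (fun ω => X ω - Y ω + |h ω|) μ := by
      have hm : AEMeasurable (fun ω => X ω - Y ω + |h ω|) μ :=
        (hX.sub hY).aemeasurable.add hh.abs.aestronglyMeasurable.aemeasurable
      refine ⟨hm.aestronglyMeasurable, ?_⟩
      have h0 : 0 ≤ᵐ[μ] fun ω => X ω - Y ω + |h ω| := by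
        filter_upwards [hle] with ω hω
        have h2 := le_abs_self (h ω)
        simp only [Pi.zero_apply]
        linarith
      rw [hasFiniteIntegral_iff_ofReal h0]
      refine lt_of_le_of_lt ?_ (ENNReal.ofReal_lt_top (r := ∫ ω, |h ω| ∂μ))
      -- Fatou's lemma: the integral of `D n + |h|` is that of `|h|` for every `n`.
      calc ∫⁻ ω, ENNReal.ofReal (X ω - Y ω + |h ω|) ∂μ
          = ∫⁻ ω, liminf (fun n => ENNReal.ofReal (D n ω + |h ω|)) atTop ∂μ := by
            refine lintegral_congr fun ω => ?_
            exact ((ENNReal.continuous_ofReal.tendsto _).comp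
              ((hDlim ω).add_const _)).liminf_eq.symm
        _ ≤ liminf (fun n => ∫⁻ ω, ENNReal.ofReal (D n ω + |h ω|) ∂μ) atTop :=
            lintegral_liminf_le' fun n => ((hDi n).aestronglyMeasurable.aemeasurable.add
              hh.abs.aestronglyMeasurable.aemeasurable).ennreal_ofReal
        _ = liminf (fun _ : ℕ => ENNReal.ofReal (∫ ω, |h ω| ∂μ)) atTop := by
            congr 1
            funext n
            have hi : Integrable (fun ω => D n ω + |h ω|) μ := (hDi n).add hh.abs
            rw [← ofReal_integral_eq_lintegral_ofReal hi (hDlow n), integral_add (hDi n) hh.abs, hD0, zero_add]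
        _ = _ := liminf_const _
    have := hsum.sub hh.abs
    refine this.congr (Eventually.of_forall fun ω => ?_)
    simp
  refine ⟨hint, ?_⟩
  have hlim := tendsto_integral_of_dominated_convergence (F := D) (fun ω => |X ω - Y ω|)
    (fun n => (hDi n).aestronglyMeasurable) hint.abs
    (fun n => Eventually.of_forall fun ω =>
      (sub_clamp_bounds (X ω) (Y ω) n).1)
    (Eventually.of_forall hDlim)
  simp only [hD0] at hlim
  exact tendsto_nhds_unique hlim tendsto_const_nhds

/-- The negative part of the log-likelihood ratio is integrable. -/
theorem integrable_max_neg_llr {Ω : Type*} [MeasurableSpace Ω] {μ ν : Measure Ω}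
    [IsFiniteMeasure μ] [IsFiniteMeasure ν] (hμν : μ ≪ ν) :
    Integrable (fun ω => max (-llr μ ν ω) 0) μ := by
  rw [← integrable_toReal_rnDeriv_mul_iff hμν]
  refine (integrable_const (1 : ℝ)).mono' ?_ (Eventually.of_forall fun ω => ?_)
  · exact ((Measure.measurable_rnDeriv μ ν).ennreal_toReal.mul
      ((measurable_llr μ ν).neg.max measurable_const)).aestronglyMeasurable
  · set r := (μ.rnDeriv ν ω).toReal with hr
    have hr0 : 0 ≤ r := ENNReal.toReal_nonneg
    have hk := InformationTheory.klFun_nonneg hr0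
    rw [InformationTheory.klFun_apply] at hk
    rw [Real.norm_of_nonneg (mul_nonneg hr0 (le_max_right _ _))]
    change r * max (-Real.log r) 0 ≤ 1
    rcases max_cases (-Real.log r) 0 with h | h <;> rw [h.1]
    · linarith
    · linarith

/-! ### Elliptical distributions -/

theorem map_withDensity_comp {α β : Type*} [MeasurableSpace α] [MeasurableSpace β] {μ : Measure α}
    {T : α → β} {f : β → ENNReal} (hT : Measurable T) (hf : Measurable f) :
    (μ.withDensity fun x => f (T x)).map T = (μ.map T).withDensity f := by
  ext A hA
  rw [Measure.map_apply hT hA, withDensity_apply _ (hT hA), withDensity_apply _ hA,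
    setLIntegral_map hA hf hT]

theorem map_linear_withDensity {a b c d : ℝ} (hD : a * d - b * c ≠ 0) {f : ℝ × ℝ → ENNReal}
    (hf : Measurable f) :
    ((volume : Measure (ℝ × ℝ)).withDensity fun p => f (a * p.1 + b * p.2, c * p.1 + d * p.2)).map
        (fun p => (a * p.1 + b * p.2, c * p.1 + d * p.2)) =
      volume.withDensity fun p => ENNReal.ofReal |(a * d - b * c)⁻¹| * f p := by
  have hT : Measurable fun p : ℝ × ℝ => (a * p.1 + b * p.2, c * p.1 + d * p.2) := by fun_prop
  rw [map_withDensity_comp hT hf]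
  let A : ℝ × ℝ →ₗ[ℝ] ℝ × ℝ :=
    Matrix.toLin (Module.Basis.finTwoProd ℝ) (Module.Basis.finTwoProd ℝ) !![a, b; c, d]
  have hdet : LinearMap.det A = a * d - b * c := by
    rw [LinearMap.det_toLin, Matrix.det_fin_two_of]
  have hA : (fun p : ℝ × ℝ => (a * p.1 + b * p.2, c * p.1 + d * p.2)) = A := by
    funext p
    exact (Matrix.toLin_finTwoProd_apply a b c d p).symm
  rw [hA, Measure.map_linearMap_addHaar_eq_smul_addHaar _ (by rw [hdet]; exact hD), hdet,
    withDensity_smul_measure, ← withDensity_smul _ hf]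
  rfl

namespace IsDensityGenerator

variable {g : ℝ → ℝ}

/-- The spherical distribution with density generator `g`. -/
def sphericalLaw (g : ℝ → ℝ) : Measure (ℝ × ℝ) :=
  volume.withDensity fun p => ENNReal.ofReal (g (p.1 ^ 2 + p.2 ^ 2))

theorem one_sub_sq_pos {θ : ℝ} (hθ : θ ∈ Ioo (-1 : ℝ) 1) : 0 < 1 - θ ^ 2 := by
  nlinarith [hθ.1, hθ.2]

theorem measurable_sphericalDensity (hg : IsDensityGenerator g) :
    Measurable fun p : ℝ × ℝ => ENNReal.ofReal (g (p.1 ^ 2 + p.2 ^ 2)) :=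
  (hg.measurable.comp (by fun_prop : Measurable fun p : ℝ × ℝ => p.1 ^ 2 + p.2 ^ 2)).ennreal_ofReal

/-- The elliptical law is a linear image of the spherical one. -/
theorem map_sphericalLaw (hg : IsDensityGenerator g) {θ : ℝ} (hθ : θ ∈ Ioo (-1 : ℝ) 1) :
    (sphericalLaw g).map (fun p => (p.1, θ * p.1 + √(1 - θ ^ 2) * p.2)) = ellipticalLaw g θ := by
  have hs := one_sub_sq_pos hθ
  have hs' := Real.sqrt_pos.2 hs
  have hf : Measurable fun p : ℝ × ℝ => ENNReal.ofReal
      (g ((p.1 ^ 2 - 2 * θ * p.1 * p.2 + p.2 ^ 2) / (1 - θ ^ 2))) :=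
    (hg.measurable.comp (by fun_prop)).ennreal_ofReal
  have := map_linear_withDensity (a := 1) (b := 0) (c := θ) (d := √(1 - θ ^ 2))
    (by simpa using hs'.ne') hf
  simp only [one_mul, zero_mul, add_zero, sub_zero] at this
  have hq : ∀ p : ℝ × ℝ, (p.1 ^ 2 - 2 * θ * p.1 * (θ * p.1 + √(1 - θ ^ 2) * p.2) +
      (θ * p.1 + √(1 - θ ^ 2) * p.2) ^ 2) / (1 - θ ^ 2) = p.1 ^ 2 + p.2 ^ 2 := by
    intro p
    rw [div_eq_iff hs.ne']
    have := Real.sq_sqrt hs.le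
    linear_combination p.2 ^ 2 * this
  simp only [hq] at this
  rw [sphericalLaw, this, ellipticalLaw]
  congr 1
  funext p
  rw [abs_of_pos (inv_pos.2 hs'), ← ENNReal.ofReal_mul (inv_pos.2 hs').le, inv_mul_eq_div]

/-- Rotational symmetry of the spherical law. -/
theorem map_sphericalLaw_eq_fst (hg : IsDensityGenerator g) {θ : ℝ} (hθ : θ ∈ Ioo (-1 : ℝ) 1) :
    (sphericalLaw g).map (fun p => θ * p.1 + √(1 - θ ^ 2) * p.2) = (sphericalLaw g).fst := by
  have hs := one_sub_sq_pos hθ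
  have hsq := Real.sq_sqrt hs.le
  -- The matrix with rows `(θ, √(1 - θ²))` and `(√(1 - θ²), -θ)` is an orthogonal reflection, hence
  -- preserves the spherical law, and its first coordinate is the required combination.
  have hD : θ * (-θ) - √(1 - θ ^ 2) * √(1 - θ ^ 2) = -1 := by linear_combination -hsq
  have := map_linear_withDensity (a := θ) (b := √(1 - θ ^ 2)) (c := √(1 - θ ^ 2)) (d := -θ)
    (by rw [hD]; norm_num) hg.measurable_sphericalDensity
  have hq : ∀ p : ℝ × ℝ, (θ * p.1 + √(1 - θ ^ 2) * p.2) ^ 2 +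
      (√(1 - θ ^ 2) * p.1 + -θ * p.2) ^ 2 = p.1 ^ 2 + p.2 ^ 2 := by
    intro p
    linear_combination (p.1 ^ 2 + p.2 ^ 2) * hsq
  rw [hD] at this
  simp only [hq, inv_neg, inv_one, abs_neg, abs_one, ENNReal.ofReal_one, one_mul] at this
  rw [← sphericalLaw] at this
  conv_rhs => rw [← this]
  rw [Measure.fst, Measure.map_map measurable_fst (by fun_prop)]
  rfl

theorem fst_ellipticalLaw (hg : IsDensityGenerator g) {θ : ℝ} (hθ : θ ∈ Ioo (-1 : ℝ) 1) :
    (ellipticalLaw g θ).fst = (sphericalLaw g).fst := by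
  rw [← hg.map_sphericalLaw hθ, Measure.fst, Measure.map_map measurable_fst (by fun_prop)]
  rfl

theorem snd_ellipticalLaw (hg : IsDensityGenerator g) {θ : ℝ} (hθ : θ ∈ Ioo (-1 : ℝ) 1) :
    (ellipticalLaw g θ).snd = (sphericalLaw g).fst := by
  rw [← hg.map_sphericalLaw_eq_fst hθ, ← hg.map_sphericalLaw hθ, Measure.snd,
    Measure.map_map measurable_snd (by fun_prop)]
  rfl

/-- The logarithm of the marginal density of the spherical law. -/
def logMarginal (g : ℝ → ℝ) (x : ℝ) : ℝ :=
  Real.log ((sphericalLaw g).fst.rnDeriv volume x).toReal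

theorem measurable_logMarginal : Measurable (logMarginal g) :=
  Real.measurable_log.comp (Measure.measurable_rnDeriv _ _).ennreal_toReal

/-- The log-likelihood ratio of an elliptical law and the product of its marginals, in spherical
coordinates. -/
def sphericalLLR (g : ℝ → ℝ) (θ : ℝ) (p : ℝ × ℝ) : ℝ :=
  Real.log (g (p.1 ^ 2 + p.2 ^ 2)) - Real.log √(1 - θ ^ 2) - logMarginal g p.1 -
    logMarginal g (θ * p.1 + √(1 - θ ^ 2) * p.2)

theorem fst_sphericalLaw_absolutelyContinuous : (sphericalLaw g).fst ≪ volume := by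
  have h : sphericalLaw g ≪ (volume : Measure (ℝ × ℝ)) := withDensity_absolutelyContinuous _ _
  refine Measure.AbsolutelyContinuous.mk fun s hs h0 => ?_
  rw [Measure.fst_apply hs, ← prod_univ]
  refine h ?_
  rw [Measure.volume_eq_prod, Measure.prod_prod, h0, zero_mul]

theorem isProbabilityMeasure_sphericalLaw (hg : IsDensityGenerator g) {θ : ℝ}
    (hθ : θ ∈ Ioo (-1 : ℝ) 1) (hP : IsProbabilityMeasure (ellipticalLaw g θ)) :
    IsProbabilityMeasure (sphericalLaw g) := by
  constructor
  have := measure_univ (μ := ellipticalLaw g θ)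
  rwa [← hg.map_sphericalLaw hθ, Measure.map_apply (by fun_prop) MeasurableSet.univ,
    preimage_univ] at this

/-- The chain rule for Radon-Nikodym derivatives with respect to Lebesgue measure expresses the
ratio through `g` and the marginal density `f`. The logarithm splits where all factors are positive
and finite, which holds almost everywhere for the elliptical law. Pulling back along the linear map
turns the quadratic form into `|p|²`. -/
theorem llr_comp_ae_eq (hg : IsDensityGenerator g) {θ : ℝ} (hθ : θ ∈ Ioo (-1 : ℝ) 1)
    [IsProbabilityMeasure (sphericalLaw g)] [IsProbabilityMeasure (ellipticalLaw g θ)]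
    (hac : ellipticalLaw g θ ≪ (sphericalLaw g).fst.prod (sphericalLaw g).fst) :
    (fun p : ℝ × ℝ => llr (ellipticalLaw g θ) ((sphericalLaw g).fst.prod (sphericalLaw g).fst)
      (p.1, θ * p.1 + √(1 - θ ^ 2) * p.2)) =ᵐ[sphericalLaw g] sphericalLLR g θ := by
  have hs := one_sub_sq_pos hθ
  have hs' := Real.sqrt_pos.2 hs
  set P := ellipticalLaw g θ with hP
  set m := (sphericalLaw g).fst with hm
  set f := m.rnDeriv volume with hf
  have hfm : Measurable f := Measure.measurable_rnDeriv _ _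
  have hmf : m = volume.withDensity f :=
    (Measure.withDensity_rnDeriv_eq m volume fst_sphericalLaw_absolutelyContinuous).symm
  have hQ : m.prod m = (volume : Measure (ℝ × ℝ)).withDensity fun p => f p.1 * f p.2 := by
    have := prod_withDensity (μ := (volume : Measure ℝ)) (ν := (volume : Measure ℝ)) hfm hfm
    rwa [← hmf, ← Measure.volume_eq_prod] at this
  have hem : Measurable fun p : ℝ × ℝ => ENNReal.ofReal
      (g ((p.1 ^ 2 - 2 * θ * p.1 * p.2 + p.2 ^ 2) / (1 - θ ^ 2)) / √(1 - θ ^ 2)) :=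
    ((hg.measurable.comp (by fun_prop)).div_const _).ennreal_ofReal
  have hPv : P ≪ volume := withDensity_absolutelyContinuous _ _
  have hQv : m.prod m ≪ volume := by rw [hQ]; exact withDensity_absolutelyContinuous _ _
  have r1 : P.rnDeriv volume =ᵐ[P] _ := hPv.ae_eq (Measure.rnDeriv_withDensity volume hem)
  have r2 : (m.prod m).rnDeriv volume =ᵐ[P] fun p => f p.1 * f p.2 := by
    refine hPv.ae_eq ?_
    conv_lhs => rw [hQ]
    exact Measure.rnDeriv_withDensity volume
      ((hfm.comp measurable_fst).mul (hfm.comp measurable_snd))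
  have r3 := hPv.ae_eq (Measure.rnDeriv_mul_rnDeriv (κ := volume) hac)
  have hmain : llr P (m.prod m) =ᵐ[P] fun p =>
      Real.log (g ((p.1 ^ 2 - 2 * θ * p.1 * p.2 + p.2 ^ 2) / (1 - θ ^ 2))) -
        Real.log √(1 - θ ^ 2) - logMarginal g p.1 - logMarginal g p.2 := by
    filter_upwards [r1, r2, r3, Measure.rnDeriv_pos hPv, hac.ae_le (Measure.rnDeriv_pos hQv),
      hPv.ae_le (Measure.rnDeriv_lt_top (m.prod m) volume), Measure.rnDeriv_pos hac,
      hac.ae_le (Measure.rnDeriv_lt_top P (m.prod m))] with p h1 h2 h3 h4 h5 h6 h7 h8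
    rw [Pi.mul_apply] at h3
    rw [h1, h2] at h3
    rw [h1] at h4
    rw [h2] at h5 h6
    have hgpos : 0 < g ((p.1 ^ 2 - 2 * θ * p.1 * p.2 + p.2 ^ 2) / (1 - θ ^ 2)) := by
      have := ENNReal.ofReal_pos.1 h4
      by_contra hc
      exact absurd this (not_lt.2 (div_nonpos_of_nonpos_of_nonneg (not_lt.1 hc) hs'.le))
    have hx0 : f p.1 ≠ 0 := (mul_ne_zero_iff.1 h5.ne').1
    have hy0 : f p.2 ≠ 0 := (mul_ne_zero_iff.1 h5.ne').2
    have hx1 : f p.1 ≠ ⊤ := fun h => h6.ne (by rw [h, ENNReal.top_mul hy0])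
    have hy1 : f p.2 ≠ ⊤ := fun h => h6.ne (by rw [h, ENNReal.mul_top hx0])
    have h9 := congrArg (fun t => Real.log t.toReal) h3
    simp only [ENNReal.toReal_mul] at h9
    rw [ENNReal.toReal_ofReal (by positivity), Real.log_div hgpos.ne' hs'.ne',
      Real.log_mul (ENNReal.toReal_pos h7.ne' h8.ne).ne'
        (mul_pos (ENNReal.toReal_pos hx0 hx1) (ENNReal.toReal_pos hy0 hy1)).ne',
      Real.log_mul (ENNReal.toReal_pos hx0 hx1).ne' (ENNReal.toReal_pos hy0 hy1).ne'] at h9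
    simp only [llr, logMarginal, ← hm, ← hf]
    linarith
  have hA : Measurable fun p : ℝ × ℝ => (p.1, θ * p.1 + √(1 - θ ^ 2) * p.2) := by fun_prop
  have hmain' : ∀ᵐ p ∂((sphericalLaw g).map fun p => (p.1, θ * p.1 + √(1 - θ ^ 2) * p.2)),
      llr P (m.prod m) p = Real.log (g ((p.1 ^ 2 - 2 * θ * p.1 * p.2 + p.2 ^ 2) / (1 - θ ^ 2))) -
        Real.log √(1 - θ ^ 2) - logMarginal g p.1 - logMarginal g p.2 := by
    rw [hg.map_sphericalLaw hθ]; exact hmain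
  filter_upwards [ae_of_ae_map hA.aemeasurable hmain'] with p hp
  rw [hp, sphericalLLR]
  have hq : (p.1 ^ 2 - 2 * θ * p.1 * (θ * p.1 + √(1 - θ ^ 2) * p.2) +
      (θ * p.1 + √(1 - θ ^ 2) * p.2) ^ 2) / (1 - θ ^ 2) = p.1 ^ 2 + p.2 ^ 2 := by
    rw [div_eq_iff hs.ne']
    have := Real.sq_sqrt hs.le
    linear_combination p.2 ^ 2 * this
  simp only [hq]

/-- On the common spherical space the two log-likelihood ratios differ by a constant and by a
difference of identically distributed marginal terms. Finite divergence at `θ₂` and integrability of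
the negative part at `θ₁` make that difference integrable with mean zero. -/
theorem mutualInfo_le (hg : IsDensityGenerator g) {θ₁ θ₂ : ℝ} {C₁ C₂ : Copula}
    (h₁ : θ₁ ∈ Ioo (-1 : ℝ) 1) (h₂ : θ₂ ∈ Ioo (-1 : ℝ) 1) (hC₁ : C₁.AbsCont) (hC₂ : C₂.AbsCont)
    (hP₁ : HasCopula (ellipticalLaw g θ₁) C₁) (hP₂ : HasCopula (ellipticalLaw g θ₂) C₂)
    (hle : θ₁ ^ 2 ≤ θ₂ ^ 2) :
    mutualInfo (ellipticalLaw g θ₁) ≤ mutualInfo (ellipticalLaw g θ₂) := by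
  have i₁ := hP₁.isProbabilityMeasure
  have i₂ := hP₂.isProbabilityMeasure
  have hZ := hg.isProbabilityMeasure_sphericalLaw h₁ i₁
  have ac₁ := hP₁.absolutelyContinuous hC₁
  have ac₂ := hP₂.absolutelyContinuous hC₂
  rw [mutualInfo, mutualInfo]
  rw [hg.fst_ellipticalLaw h₁, hg.snd_ellipticalLaw h₁] at ac₁ ⊢
  rw [hg.fst_ellipticalLaw h₂, hg.snd_ellipticalLaw h₂] at ac₂ ⊢
  set Z := sphericalLaw g with hZdef
  set Q := Z.fst.prod Z.fst with hQ
  have e₁ := hg.llr_comp_ae_eq h₁ ac₁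
  have e₂ := hg.llr_comp_ae_eq h₂ ac₂
  have hA : ∀ θ : ℝ, Measurable fun p : ℝ × ℝ => (p.1, θ * p.1 + √(1 - θ ^ 2) * p.2) := fun θ => by
    fun_prop
  have hW : ∀ θ : ℝ, Measurable fun p : ℝ × ℝ => θ * p.1 + √(1 - θ ^ 2) * p.2 := fun θ => by
    fun_prop
  have hint : ∀ θ ∈ Ioo (-1 : ℝ) 1, ∀ F : ℝ × ℝ → ℝ, Measurable F →
      (Integrable F (ellipticalLaw g θ) ↔
        Integrable (fun p => F (p.1, θ * p.1 + √(1 - θ ^ 2) * p.2)) Z) := by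
    intro θ hθ F hF
    rw [← hg.map_sphericalLaw hθ]
    exact integrable_map_measure hF.aestronglyMeasurable (hA θ).aemeasurable
  have hval : ∀ θ ∈ Ioo (-1 : ℝ) 1, ∀ F : ℝ × ℝ → ℝ, Measurable F →
      ∫ p, F p ∂(ellipticalLaw g θ) = ∫ p, F (p.1, θ * p.1 + √(1 - θ ^ 2) * p.2) ∂Z := by
    intro θ hθ F hF
    rw [← hg.map_sphericalLaw hθ]
    exact integral_map (hA θ).aemeasurable hF.aestronglyMeasurable
  by_cases hi₂ : Integrable (llr (ellipticalLaw g θ₂) Q) (ellipticalLaw g θ₂)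
  swap
  · rw [InformationTheory.klDiv_of_not_integrable hi₂]; exact le_top
  have hL₂ : Integrable (sphericalLLR g θ₂) Z :=
    ((hint θ₂ h₂ _ (measurable_llr _ _)).1 hi₂).congr e₂
  have hn₁ : Integrable (fun p => max (-sphericalLLR g θ₁ p) 0) Z := by
    refine ((hint θ₁ h₁ _ ((measurable_llr _ _).neg.max measurable_const)).1
      (integrable_max_neg_llr ac₁)).congr ?_
    filter_upwards [e₁] with p hp
    exact congrArg (fun t => max (-t) 0) hp
  have hs₁ := Real.sqrt_pos.2 (one_sub_sq_pos h₁)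
  have hs₂ := Real.sqrt_pos.2 (one_sub_sq_pos h₂)
  have hκ : Real.log √(1 - θ₂ ^ 2) ≤ Real.log √(1 - θ₁ ^ 2) :=
    Real.log_le_log hs₂ (Real.sqrt_le_sqrt (by linarith))
  have hdiff : ∀ p, sphericalLLR g θ₁ p = sphericalLLR g θ₂ p +
      (logMarginal g (θ₂ * p.1 + √(1 - θ₂ ^ 2) * p.2) -
        logMarginal g (θ₁ * p.1 + √(1 - θ₁ ^ 2) * p.2)) -
      (Real.log √(1 - θ₁ ^ 2) - Real.log √(1 - θ₂ ^ 2)) := by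
    intro p; simp only [sphericalLLR]; ring
  have hlaw : ∀ θ ∈ Ioo (-1 : ℝ) 1,
      Z.map (fun p => logMarginal g (θ * p.1 + √(1 - θ ^ 2) * p.2)) =
        Z.fst.map (logMarginal g) := by
    intro θ hθ
    rw [← hg.map_sphericalLaw_eq_fst hθ, Measure.map_map measurable_logMarginal (hW θ)]
    rfl
  -- By `hdiff` and `hκ` the difference of marginal terms is at least the ratio at `θ₁` minus the
  -- ratio at `θ₂`, which yields this integrable lower bound.
  obtain ⟨hXi, hX0⟩ := integrable_sub_of_map_eq (μ := Z)
    (X := fun p => logMarginal g (θ₂ * p.1 + √(1 - θ₂ ^ 2) * p.2))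
    (Y := fun p => logMarginal g (θ₁ * p.1 + √(1 - θ₁ ^ 2) * p.2))
    (h := fun p => max (-sphericalLLR g θ₁ p) 0 + |sphericalLLR g θ₂ p|)
    (measurable_logMarginal.comp (hW θ₂)) (measurable_logMarginal.comp (hW θ₁))
    ((hlaw θ₂ h₂).trans (hlaw θ₁ h₁).symm) (hn₁.add hL₂.abs)
    (Eventually.of_forall fun p => by
      have := hdiff p
      have := le_max_left (-sphericalLLR g θ₁ p) 0
      have := le_abs_self (sphericalLLR g θ₂ p)
      linarith)
  have hL₁ : Integrable (sphericalLLR g θ₁) Z := by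
    rw [funext hdiff]
    exact (hL₂.add hXi).sub (integrable_const _)
  have hi₁ : Integrable (llr (ellipticalLaw g θ₁) Q) (ellipticalLaw g θ₁) :=
    (hint θ₁ h₁ _ (measurable_llr _ _)).2 (hL₁.congr e₁.symm)
  rw [InformationTheory.klDiv_of_ac_of_integrable ac₁ hi₁,
    InformationTheory.klDiv_of_ac_of_integrable ac₂ hi₂, hval θ₁ h₁ _ (measurable_llr _ _),
    hval θ₂ h₂ _ (measurable_llr _ _), integral_congr_ae e₁, integral_congr_ae e₂]
  refine ENNReal.ofReal_le_ofReal ?_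
  have hI : ∫ p, sphericalLLR g θ₁ p ∂Z = ∫ p, sphericalLLR g θ₂ p ∂Z -
      (Real.log √(1 - θ₁ ^ 2) - Real.log √(1 - θ₂ ^ 2)) := by
    have hadd : Integrable (fun p => sphericalLLR g θ₂ p +
        (logMarginal g (θ₂ * p.1 + √(1 - θ₂ ^ 2) * p.2) -
          logMarginal g (θ₁ * p.1 + √(1 - θ₁ ^ 2) * p.2))) Z := hL₂.add hXi
    rw [integral_congr_ae (Eventually.of_forall hdiff), integral_sub hadd
      (integrable_const _), integral_add hL₂ hXi, hX0, add_zero]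
    simp
  rw [hI, probReal_univ, probReal_univ, probReal_univ]
  linarith

end IsDensityGenerator

theorem AwayFromZero.sq_le_sq {θ₁ θ₂ : ℝ} (h : AwayFromZero θ₁ θ₂) : θ₁ ^ 2 ≤ θ₂ ^ 2 := by
  rcases h with h | h <;> nlinarith [h.1, h.2]

end

/-! ### The four families -/

theorem mainTheorem1 :
    -- (a) supermodular monotonicity and a TP2 (RR2) density
    (∀ (Θ : Set ℝ) (C : ℝ → Copula), (∀ θ ∈ Θ, (C θ).AbsCont) →
      ((Θ ⊆ Ici 0 ∧
          (∀ θ₁ ∈ Θ, ∀ θ₂ ∈ Θ, θ₁ ≤ θ₂ → SMOrder (C θ₁).law (C θ₂).law) ∧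
          ∀ θ ∈ Θ, (C θ).HasTP2Density) ∨
        (Θ ⊆ Iic 0 ∧
          (∀ θ₁ ∈ Θ, ∀ θ₂ ∈ Θ, θ₂ ≤ θ₁ → SMOrder (C θ₂).law (C θ₁).law) ∧
          ∀ θ ∈ Θ, (C θ).HasRR2Density)) →
      EntropyMonotone Θ C) ∧
    -- (b) Archimedean copulas
    (∀ (Θ : Set ℝ) (C : ℝ → Copula) (φ : ℝ → ℝ → ℝ), (∀ θ ∈ Θ, (C θ).AbsCont) →
      (∀ θ ∈ Θ, IsArchimedean (C θ) (φ θ) ∧ IsCompletelyMonotone (φ θ) ∧ φ θ 0 = 1) →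
      (∀ θ₁ ∈ Θ, ∀ θ₂ ∈ Θ, AwayFromZero θ₁ θ₂ → SMOrder (C θ₁).law (C θ₂).law) →
      EntropyMonotone Θ C) ∧
    -- (c) two-parameter Archimedean copulas, for a fixed second parameter
    (∀ (Θ : Set ℝ) (C : ℝ → ℝ → Copula) (K : ℝ → Copula) (ψ φ : ℝ → ℝ → ℝ) (δ : ℝ),
      (∀ θ ∈ Θ, (C θ δ).AbsCont) →
      (∀ θ ∈ Θ, IsTwoParamArchimedean (C θ δ) (K δ) (ψ θ) (φ δ) ∧
        IsCompletelyMonotone (twoParamGenerator (ψ θ) (φ δ)) ∧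
        twoParamGenerator (ψ θ) (φ δ) 0 = 1) →
      (∀ θ₁ ∈ Θ, ∀ θ₂ ∈ Θ, AwayFromZero θ₁ θ₂ → SMOrder (C θ₁ δ).law (C θ₂ δ).law) →
      EntropyMonotone Θ fun θ => C θ δ) ∧
    -- (d) elliptical copulas
    (∀ (Θ : Set ℝ) (C : ℝ → Copula) (g : ℝ → ℝ), (∀ θ ∈ Θ, (C θ).AbsCont) →
      Θ ⊆ Ioo (-1) 1 → IsDensityGenerator g →
      (∀ θ ∈ Θ, HasCopula (ellipticalLaw g θ) (C θ)) →
      EntropyMonotone Θ C) := by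
  refine ⟨?_, ?_, ?_, ?_⟩
  · intro Θ C hC h
    refine entropyMonotone_of_divergence_le hC fun θ₁ m₁ θ₂ m₂ haz => ?_
    rcases h with ⟨hΘ, hsm, hd⟩ | ⟨hΘ, hsm, hd⟩
    · have hle : θ₁ ≤ θ₂ := by
        rcases haz with h | h
        · exact h.2
        · exact h.2.trans (hΘ m₂)
      exact Copula.divergence_le_of_rectTP2 (hC _ m₁) (hC _ m₂) (hd _ m₁).rectTP2
        (hsm _ m₁ _ m₂ hle)
    · have hle : θ₂ ≤ θ₁ := by
        rcases haz with h | h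
        · exact (hΘ m₂).trans h.1
        · exact h.1
      exact Copula.divergence_le_of_rectRR2 (hC _ m₁) (hC _ m₂) (hd _ m₁).rectRR2
        (hsm _ m₁ _ m₂ hle)
  · intro Θ C φ hC hφ hsm
    exact entropyMonotone_of_divergence_le hC fun θ₁ m₁ θ₂ m₂ haz =>
      Copula.divergence_le_of_rectTP2 (hC _ m₁) (hC _ m₂)
        ((hφ _ m₁).1.rectTP2 (hφ _ m₁).2.1) (hsm _ m₁ _ m₂ haz)
  · intro Θ C K ψ φ δ hC hφ hsm
    exact entropyMonotone_of_divergence_le hC fun θ₁ m₁ θ₂ m₂ haz =>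
      Copula.divergence_le_of_rectTP2 (hC _ m₁) (hC _ m₂)
        ((hφ _ m₁).1.rectTP2 (hφ _ m₁).2.1) (hsm _ m₁ _ m₂ haz)
  · intro Θ C g hC hΘ hg hP
    refine entropyMonotone_of_divergence_le hC fun θ₁ m₁ θ₂ m₂ haz => ?_
    -- The elliptical laws themselves are vectors with these copulas, so their mutual information
    -- computes the divergence.
    rw [← (hP _ m₁).mutualInfo_eq (hC _ m₁), ← (hP _ m₂).mutualInfo_eq (hC _ m₂)]
    exact hg.mutualInfo_le (hΘ m₁) (hΘ m₂) (hC _ m₁) (hC _ m₂) (hP _ m₁) (hP _ m₂) haz.sq_le_sq
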